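/- Let $\mu>-\tfrac12$ and let $d\lambda_\mu(x)=|x|^{2\mu}e^{-x^2}\,dx$ on $\mathbb{R}$. For $\alpha>-1$ let $L_m^{\alpha}(x)=\sum_{k=0}^m(-1)^k\frac{\Gamma(m+\alpha+1)}{\Gamma(k+\alpha+1)\,(m-k)!}\,\frac{x^k}{k!}$ be the Laguerre polynomials, and define the generalized Hermite polynomials and the generalized factorial by $$H_{2m}^{\mu}(x)=(-1)^m(2m)!\,\frac{\Gamma(\mu+\frac12)}{\Gamma(m+\mu+\frac12)}\,L_m^{\mu-\frac12}(x^2),\qquad H_{2m+1}^{\mu}(x)=(-1)^m(2m+1)!\,\frac{\Gamma(\mu+\frac12)}{\Gamma(m+\mu+\frac32)}\,x\,L_m^{\mu+\frac12}(x^2),$$ $$\gamma_\mu(2m)=\frac{2^{2m}\,m!\,\Gamma(m+\mu+\frac12)}{\Gamma(\mu+\frac12)},\qquad \gamma_\mu(2m+1)=\frac{2^{2m+1}\,m!\,\Gamma(m+\mu+\frac32)}{\Gamma(\mu+\frac12)}.$$ For $t>0$ and $x\in\mathbb{R}$ the generalized Ornstein-Uhlenbeck semigroup and its maximal function are $$T_\mu^tf(x)=\int_{\mathbb{R}}\Big(\sum_{n=0}^\infty\frac{\gamma_\mu(n)}{2^n(n!)^2\,\Gamma(\mu+\frac12)}\,H_n^\mu(x)H_n^\mu(y)\,e^{-nt}\Big)f(y)\,d\lambda_\mu(y),\qquad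 T_\mu^*f(x)=\sup_{t>0}|T_\mu^tf(x)|.$$ Then for every $1<p\le\infty$ there is a constant $C<\infty$, depending only on $\mu$ and $p$, such that for every real- or complex-valued $f\in L^p(d\lambda_\mu)$ $$\|T_\mu^*f\|_{L^p(d\lambda_\mu)}\le C\,\|f\|_{L^p(d\lambda_\mu)}.$$ Here, for all $t>0$ and $x,y\in\mathbb{R}$, the series and the integral defining $T_\mu^tf(x)$ converge absolutely, and $T_\mu^*f$ is $\lambda_\mu$-measurable. -/

import Mathlib

open MeasureTheory
open scoped ENNReal NNReal

noncomputable section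

namespace GenOU

/-- The measure `dλ_μ(x) = |x|^{2μ} e^{-x²} dx` on `ℝ`. -/
def lam (μ : ℝ) : Measure ℝ :=
  volume.withDensity fun x => ENNReal.ofReal (|x| ^ (2 * μ) * Real.exp (-x ^ 2))

/-- The Laguerre polynomial `L_m^α(x) = ∑_{k ≤ m} (-1)^k binom(m + α, m - k) x^k / k!`
(for `α > -1`), the binomial coefficient being written with Gamma functions. -/
def laguerre (α : ℝ) (m : ℕ) (x : ℝ) : ℝ :=
  ∑ k ∈ Finset.range (m + 1),
    (-1) ^ k * (Real.Gamma (m + α + 1) /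
      (Real.Gamma (k + α + 1) * ((m - k).factorial : ℝ))) * (x ^ k / (k.factorial : ℝ))

/-- The generalized factorial `γ_μ(n)`, where `n = 2m` or `n = 2m + 1` with `m = n / 2`. -/
def genFactorial (μ : ℝ) (n : ℕ) : ℝ :=
  if Even n then
    2 ^ n * ((n / 2).factorial : ℝ) * Real.Gamma ((n / 2 : ℕ) + μ + 1 / 2) /
      Real.Gamma (μ + 1 / 2)
  else
    2 ^ n * ((n / 2).factorial : ℝ) * Real.Gamma ((n / 2 : ℕ) + μ + 3 / 2) /
      Real.Gamma (μ + 1 / 2)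

/-- The generalized Hermite polynomial `H_n^μ` (in Rosenblum's normalization),
where `n = 2m` or `n = 2m + 1` with `m = n / 2`. -/
def genHermite (μ : ℝ) (n : ℕ) (x : ℝ) : ℝ :=
  if Even n then
    (-1) ^ (n / 2) * (n.factorial : ℝ) *
      (Real.Gamma (μ + 1 / 2) / Real.Gamma ((n / 2 : ℕ) + μ + 1 / 2)) *
        laguerre (μ - 1 / 2) (n / 2) (x ^ 2)
  else
    (-1) ^ (n / 2) * (n.factorial : ℝ) *
      (Real.Gamma (μ + 1 / 2) / Real.Gamma ((n / 2 : ℕ) + μ + 3 / 2)) *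
        (x * laguerre (μ + 1 / 2) (n / 2) (x ^ 2))

/-- The `n`-th term `e^{-nt} H_n^μ(x) H_n^μ(y) / ‖H_n^μ‖²` of the kernel of the semigroup; here
`‖H_n^μ‖² = 2^n (n!)² Γ(μ + 1/2) / γ_μ(n)` is the squared norm in `L²(dλ_μ)`. -/
def kernelTerm (μ t x y : ℝ) (n : ℕ) : ℝ :=
  genFactorial μ n / (2 ^ n * (n.factorial : ℝ) ^ 2 * Real.Gamma (μ + 1 / 2)) *
    genHermite μ n x * genHermite μ n y * Real.exp (-(n * t))

/-- The density with respect to `λ_μ(dy)` of the kernel `P_t(x, dy)` of the generalized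
Ornstein-Uhlenbeck semigroup. -/
def kernel (μ t x y : ℝ) : ℝ :=
  ∑' n : ℕ, kernelTerm μ t x y n

/-- The generalized Ornstein-Uhlenbeck semigroup `T_μ^t f(x) = ∫ f(y) P_t(x, dy)`. -/
def semigroup {𝕜 : Type*} [RCLike 𝕜] (μ t : ℝ) (f : ℝ → 𝕜) (x : ℝ) : 𝕜 :=
  ∫ y, kernel μ t x y • f y ∂(lam μ)

/-- The maximal function `T_μ^* f(x) = sup_{t > 0} |T_μ^t f(x)|`, with values in `[0, ∞]`. -/
def maximal {𝕜 : Type*} [RCLike 𝕜] (μ : ℝ) (f : ℝ → 𝕜) (x : ℝ) : ℝ≥0∞ :=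
  ⨆ (t : ℝ) (_ : 0 < t), ‖semigroup μ t f x‖ₑ

end GenOU

end

/-! ### Symmetric Markov kernels and the reversed chain -/

noncomputable section

namespace GenOU

open ProbabilityTheory Finset

/-! The kernel splits according to the parity of `n`. With `r = e^{-t}`, the even terms form the
Laguerre kernel of type `μ - 1/2` at `(x², y²)` with parameter `r²`, and the odd terms form `r x y`
times the Laguerre kernel of type `μ + 1/2`. The Hille-Hardy formula (`lagKernel_eq`) sums both in
closed form: a positive factor times a normalized modified Bessel function, a power series with
positive coefficients. Hence the even kernel is nonnegative. The comparison of Bessel functions of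
consecutive orders (`mul_besselSeries_succ_le`) bounds the odd part by a multiple of the even part,
uniformly in `t`, `x`, `y` (`abs_kernel_le`). It remains to bound the maximal function of the even
part on nonnegative functions.

Orthogonality of the Laguerre polynomials makes the even kernels a semigroup
(`integral_lagKernel_mul_lagKernel`) of total mass one (`integral_lagKernel`), and they are visibly
symmetric. So each of them is a Markov kernel symmetric with respect to `lam μ`, a finite measure.
For `p = ∞` mass one is enough. For finite `p` one uses Rota's maximal inequality for the even
powers of a symmetric Markov operator (`lintegral_sup_avg_rpow_le`), whose constant is the conjugate
exponent `q`, whatever the operator and the number of powers. Applied to the operator at time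
`2^{-(j+1)}` it controls all times `(n+1)/2^j`; monotone convergence in `j` gives all dyadic times,
and continuity in `t` all positive times.

Rota's inequality is proved in dual form. Let `X_N, ..., X_0` be a stationary reversible chain, run
towards `X_0`, and let `S` be the sum over `n < N` of `E[h_n(X_0) | X_n]`. By reversibility,
conditioning `S` on `X_0` produces the sum of the `2n`-th averages of `h_n`. Convexity of `s^q` and
the Markov property give `E S^q ≤ q E[S^{q-1} ∑ h_n(X_0)]`, and Hölder turns this into `‖S‖_q ≤ q ‖∑
h_n‖_q`. Linearizing the maximum `M` by splitting `M^{p-1}` into functions `h_n` returns the maximal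
inequality. No path space is needed: the joint law of `(X_0, S)` suffices and is built by induction
on `N` (`exists_chain_measure`). -/

theorem ENNReal_add_rpow_le {q : ℝ} (hq : 1 ≤ q) (a b : ℝ≥0∞) :
    (a + b) ^ q ≤ a ^ q + ENNReal.ofReal q * ((a + b) ^ (q - 1) * b) := by
  have hq0 : 0 < q := by linarith
  rcases eq_or_ne a ∞ with rfl | ha
  · simp [ENNReal.top_rpow_of_pos hq0]
  rcases eq_or_ne b ∞ with rfl | hb
  · have h1 : (∞ : ℝ≥0∞) ^ (q - 1) ≠ 0 := by
      rcases hq.eq_or_lt with rfl | h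
      · simp
      · simp [ENNReal.top_rpow_of_pos (sub_pos.2 h)]
    have h2 : ENNReal.ofReal q ≠ 0 := by simpa using hq0
    simp [ENNReal.mul_top h1, ENNReal.mul_top h2]
  lift a to ℝ≥0 using ha
  lift b to ℝ≥0 using hb
  rcases eq_or_ne (a + b) 0 with h0 | h0
  · obtain ⟨rfl, rfl⟩ : a = 0 ∧ b = 0 := by simpa using h0
    simp [hq0]
  have hc : (0 : ℝ) < a + b := by
    have : (0 : ℝ≥0) < a + b := pos_iff_ne_zero.2 h0
    exact_mod_cast this
  have key : ((a : ℝ) + b) ^ q ≤ (a : ℝ) ^ q + q * (((a : ℝ) + b) ^ (q - 1) * b) := by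
    -- Bernoulli's inequality for `a / (a + b) = 1 - b / (a + b)`, to be multiplied by `(a + b)^q`.
    have hb := one_add_mul_self_le_rpow_one_add (s := -(b : ℝ) / (a + b)) (p := q)
      (by rw [le_div_iff₀ hc]; linarith [a.2, show (0 : ℝ) ≤ a from a.2]) hq
    have e : 1 + -(b : ℝ) / (a + b) = a / (a + b) := by field_simp; ring
    rw [e, Real.div_rpow (NNReal.coe_nonneg a) hc.le, le_div_iff₀ (Real.rpow_pos_of_pos hc q)] at hb
    have e2 : ((a : ℝ) + b) ^ q = ((a : ℝ) + b) ^ (q - 1) * (a + b) := by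
      rw [Real.rpow_sub_one hc.ne']; field_simp
    have e3 : (1 + q * (-(b : ℝ) / (a + b))) * (a + b) ^ q
        = ((a : ℝ) + b) ^ q - q * (((a : ℝ) + b) ^ (q - 1) * b) := by
      rw [e2]; field_simp; ring
    rw [e3] at hb
    linarith
  have key' : (a + b) ^ q ≤ a ^ q + q.toNNReal * ((a + b) ^ (q - 1) * b) := by
    rw [← NNReal.coe_le_coe]
    push_cast
    rw [Real.coe_toNNReal q hq0.le]
    exact key
  have hne : (a + b : ℝ≥0∞) = ((a + b : ℝ≥0) : ℝ≥0∞) := by push_cast; rfl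
  rw [hne, ← ENNReal.coe_rpow_of_nonneg _ hq0.le, ← ENNReal.coe_rpow_of_nonneg _ hq0.le,
    ← ENNReal.coe_rpow_of_nonneg _ (by linarith : 0 ≤ q - 1), ENNReal.ofReal]
  exact_mod_cast key'

variable {X : Type*} [MeasurableSpace X]

/-- The averaging operator of a transition kernel. -/
def avg (κ : Kernel X X) (f : X → ℝ≥0∞) (x : X) : ℝ≥0∞ := ∫⁻ y, f y ∂κ x

theorem measurable_avg (κ : Kernel X X) {f : X → ℝ≥0∞} (hf : Measurable f) :
    Measurable (avg κ f) := hf.lintegral_kernel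

theorem measurable_avg_iterate (κ : Kernel X X) {f : X → ℝ≥0∞} (hf : Measurable f) (n : ℕ) :
    Measurable ((avg κ)^[n] f) := by
  induction n with
  | zero => exact hf
  | succ n ih => rw [Function.iterate_succ_apply']; exact measurable_avg κ ih

theorem avg_mono (κ : Kernel X X) {f g : X → ℝ≥0∞} (h : f ≤ g) : avg κ f ≤ avg κ g :=
  fun _ => lintegral_mono h

theorem avg_iterate_mono (κ : Kernel X X) {f g : X → ℝ≥0∞} (h : f ≤ g) (n : ℕ) :
    (avg κ)^[n] f ≤ (avg κ)^[n] g := by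
  induction n with
  | zero => exact h
  | succ n ih => simp only [Function.iterate_succ_apply']; exact avg_mono κ ih

theorem avg_le_const (κ : Kernel X X) [IsMarkovKernel κ] {f : X → ℝ≥0∞} {c : ℝ≥0∞}
    (h : ∀ x, f x ≤ c) (x : X) : avg κ f x ≤ c :=
  (lintegral_mono h).trans (by simp)

theorem avg_iterate_le_const (κ : Kernel X X) [IsMarkovKernel κ] {f : X → ℝ≥0∞} {c : ℝ≥0∞}
    (h : ∀ x, f x ≤ c) (n : ℕ) (x : X) : (avg κ)^[n] f x ≤ c := by
  induction n generalizing x with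
  | zero => exact h x
  | succ n ih => rw [Function.iterate_succ_apply']; exact avg_le_const κ ih x

theorem avg_sum (κ : Kernel X X) {h : ℕ → X → ℝ≥0∞} (hh : ∀ n, Measurable (h n)) (N : ℕ) (x : X) :
    avg κ (fun y => ∑ n ∈ range N, h n y) x = ∑ n ∈ range N, avg κ (h n) x :=
  lintegral_finsetSum _ fun n _ => hh n

theorem avg_iSup (κ : Kernel X X) {f : ℕ → X → ℝ≥0∞} (hf : ∀ m, Measurable (f m))
    (hm : Monotone f) : avg κ (fun x => ⨆ m, f m x) = fun x => ⨆ m, avg κ (f m) x := by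
  ext x; exact lintegral_iSup hf hm

theorem avg_iterate_iSup (κ : Kernel X X) {f : ℕ → X → ℝ≥0∞} (hf : ∀ m, Measurable (f m))
    (hm : Monotone f) (n : ℕ) :
    (avg κ)^[n] (fun x => ⨆ m, f m x) = fun x => ⨆ m, (avg κ)^[n] (f m) x := by
  induction n with
  | zero => rfl
  | succ n ih =>
    simp only [Function.iterate_succ_apply']
    rw [ih]
    exact avg_iSup κ (fun m => measurable_avg_iterate κ (hf m) n)
      fun i j hij => avg_iterate_mono κ (hm hij) n

/-- The averaging operator of `κ` is symmetric with respect to `π`. -/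
def IsSymmetricKernel (κ : Kernel X X) (π : Measure X) : Prop :=
  ∀ f g : X → ℝ≥0∞, Measurable f → Measurable g →
    ∫⁻ x, avg κ f x * g x ∂π = ∫⁻ x, f x * avg κ g x ∂π

theorem IsSymmetricKernel.iterate {κ : Kernel X X} {π : Measure X} (hs : IsSymmetricKernel κ π)
    (n : ℕ) {f g : X → ℝ≥0∞} (hf : Measurable f) (hg : Measurable g) :
    ∫⁻ x, (avg κ)^[n] f x * g x ∂π = ∫⁻ x, f x * (avg κ)^[n] g x ∂π := by
  induction n generalizing g with
  | zero => rfl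
  | succ n ih =>
    rw [Function.iterate_succ_apply', hs _ _ (measurable_avg_iterate κ hf n) hg,
      ih (measurable_avg κ hg), Function.iterate_succ_apply]

theorem IsSymmetricKernel.invariant {κ : Kernel X X} [IsMarkovKernel κ] {π : Measure X}
    (hs : IsSymmetricKernel κ π) {f : X → ℝ≥0∞} (hf : Measurable f) :
    ∫⁻ x, avg κ f x ∂π = ∫⁻ x, f x ∂π := by
  have := hs f (fun _ => 1) hf measurable_const
  simpa [avg] using this

/-- One step of the Markov chain with an additive functional carried along. -/
def stepMeasure (κ : Kernel X X) (Z : X → ℝ≥0∞) (ν : Measure (X × ℝ≥0∞)) : Measure (X × ℝ≥0∞) :=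
  (ν.compProd (κ.comap Prod.fst measurable_fst)).map fun w => (w.2, w.1.2 + Z w.2)

theorem measurable_step {Z : X → ℝ≥0∞} (hZ : Measurable Z) :
    Measurable fun w : (X × ℝ≥0∞) × X => (w.2, w.1.2 + Z w.2) := by fun_prop

theorem lintegral_stepMeasure (κ : Kernel X X) [IsMarkovKernel κ] {Z : X → ℝ≥0∞}
    (hZ : Measurable Z) (ν : Measure (X × ℝ≥0∞)) [SFinite ν] {F : X × ℝ≥0∞ → ℝ≥0∞}
    (hF : Measurable F) :
    ∫⁻ z, F z ∂(stepMeasure κ Z ν) = ∫⁻ z, ∫⁻ y, F (y, z.2 + Z y) ∂κ z.1 ∂ν := by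
  rw [stepMeasure, lintegral_map hF (measurable_step hZ),
    Measure.lintegral_compProd (f := fun w : (X × ℝ≥0∞) × X => F (w.2, w.1.2 + Z w.2))
      (hF.comp (measurable_step hZ))]
  rfl

instance (κ : Kernel X X) [IsMarkovKernel κ] (Z : X → ℝ≥0∞) (ν : Measure (X × ℝ≥0∞)) [SFinite ν] :
    SFinite (stepMeasure κ Z ν) := by
  unfold stepMeasure; infer_instance

/-- Follow a stationary chain with transition kernel `κ` backwards in time and add up the
conditional expectations of `h n` at its end point, given the chain up to time `n`. The measure
`ν` is the joint law of the end point and of this sum. -/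
theorem exists_chain_measure {κ : Kernel X X} [IsMarkovKernel κ] {π : Measure X} [SFinite π]
    (hs : IsSymmetricKernel κ π) {q : ℝ} (hq : 1 ≤ q) (N : ℕ) :
    ∀ h : ℕ → X → ℝ≥0∞, (∀ n, Measurable (h n)) → ∃ ν : Measure (X × ℝ≥0∞), SFinite ν ∧
      (∀ φ : X → ℝ≥0∞, Measurable φ → ∫⁻ z, φ z.1 ∂ν = ∫⁻ x, φ x ∂π) ∧
      (∀ φ : X → ℝ≥0∞, Measurable φ → ∫⁻ z, z.2 * φ z.1 ∂ν =
        ∫⁻ x, (∑ n ∈ range N, (avg κ)^[2 * n] (h n) x) * φ x ∂π) ∧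
      ∫⁻ z, z.2 ^ q ∂ν ≤
        ENNReal.ofReal q * ∫⁻ z, z.2 ^ (q - 1) * ∑ n ∈ range N, h n z.1 ∂ν ∧
      (∀ c : ℝ≥0∞, (∀ n x, h n x ≤ c) → ∀ᵐ z ∂ν, z.2 ≤ N * c) := by
  induction N with
  | zero =>
    intro h hh
    have hm : Measurable fun x : X => (x, (0 : ℝ≥0∞)) := by fun_prop
    refine ⟨π.map fun x => (x, 0), inferInstance, fun φ hφ => ?_, fun φ hφ => ?_, ?_, ?_⟩
    · rw [lintegral_map (f := fun z : X × ℝ≥0∞ => φ z.1)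
        (hφ.comp measurable_fst) hm]
    · rw [lintegral_map (f := fun z : X × ℝ≥0∞ => z.2 * φ z.1)
        (measurable_snd.mul (hφ.comp measurable_fst)) hm]
      simp
    · rw [lintegral_map (measurable_snd.pow_const q) hm]
      simp [show 0 < q by linarith]
    · intro c _
      rw [ae_map_iff hm.aemeasurable (measurableSet_le measurable_snd measurable_const)]
      simp
  | succ N ih =>
    intro h hh
    -- The chain up to `X_1` is a chain of length `N` ending at `X_1`. Seen from there, the
    -- prediction of `h (n + 1)` at `X_0` is the prediction of `avg κ (h (n + 1))` at `X_1`; the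
    -- term `h 0` enters only with the last step.
    obtain ⟨ν, hν, h1, h2, h3, h4⟩ := ih (fun n => avg κ (h (n + 1)))
      fun n => measurable_avg κ (hh _)
    have hq1 : 0 ≤ q - 1 := by linarith
    have h0 := hh 0
    have hS : Measurable fun x => ∑ n ∈ range N, h (n + 1) x :=
      Finset.measurable_sum _ fun n _ => hh _
    refine ⟨stepMeasure κ (h 0) ν, inferInstance, fun φ hφ => ?_, fun φ hφ => ?_, ?_, ?_⟩
    · rw [lintegral_stepMeasure κ h0 ν (F := fun z => φ z.1) (hφ.comp measurable_fst)]
      exact (h1 _ (measurable_avg κ hφ)).trans (hs.invariant hφ)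
    · rw [lintegral_stepMeasure κ h0 ν (F := fun z => z.2 * φ z.1)
        (measurable_snd.mul (hφ.comp measurable_fst))]
      have e : ∀ z : X × ℝ≥0∞, ∫⁻ y, (z.2 + h 0 y) * φ y ∂κ z.1 =
          z.2 * avg κ φ z.1 + avg κ (fun y => h 0 y * φ y) z.1 := by
        intro z
        simp only [add_mul]
        rw [lintegral_add_left (hφ.const_mul _), lintegral_const_mul _ hφ]; rfl
      simp only [e]
      have hb := measurable_avg κ hφ
      have h0φ : Measurable fun y => h 0 y * φ y := h0.mul hφ
      have hR : Measurable fun x => ∑ n ∈ range N, (avg κ)^[2 * n] (avg κ (h (n + 1))) x :=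
        Finset.measurable_sum _ fun n _ => measurable_avg_iterate κ (measurable_avg κ (hh _)) _
      -- Symmetry moves the average from `φ` to the sum. Together with the average inside `avg κ (h
      -- (n + 1))` this raises the power from `2 * n` to `2 * (n + 1)`.
      rw [lintegral_add_left (f := fun z : X × ℝ≥0∞ => z.2 * avg κ φ z.1)
        (measurable_snd.mul (hb.comp measurable_fst)), h2 _ hb,
        h1 _ (measurable_avg κ h0φ), hs.invariant h0φ, ← hs _ _ hR hφ,
        ← lintegral_add_left (f := fun x => avg κ (fun x => ∑ n ∈ range N,
          (avg κ)^[2 * n] (avg κ (h (n + 1))) x) x * φ x) ((measurable_avg κ hR).mul hφ)]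
      refine lintegral_congr fun x => ?_
      rw [avg_sum κ (fun n => measurable_avg_iterate κ (measurable_avg κ (hh _)) _), ← add_mul,
        Finset.sum_range_succ']
      refine congrArg (fun s => (s + h 0 x) * φ x) (Finset.sum_congr rfl fun n _ => ?_)
      rw [← Function.iterate_succ_apply' (avg κ), ← Function.iterate_succ_apply (avg κ)]
      rfl
    · have hsum : Measurable fun z : X × ℝ≥0∞ => ∑ n ∈ range (N + 1), h n z.1 :=
        Finset.measurable_sum _ fun n _ => (hh n).comp measurable_fst
      rw [lintegral_stepMeasure κ h0 ν (F := fun z => z.2 ^ q) (measurable_snd.pow_const q),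
        lintegral_stepMeasure κ h0 ν (F := fun z => z.2 ^ (q - 1) * ∑ n ∈ range (N + 1), h n z.1)
          ((measurable_snd.pow_const _).mul hsum)]
      have hG : Measurable fun w : (X × ℝ≥0∞) × X => (w.1.2 + h 0 w.2) ^ (q - 1) * h 0 w.2 := by
        fun_prop
      have hA : ∀ a : ℝ≥0∞, Measurable fun y => (a + h 0 y) ^ (q - 1) * h 0 y := by
        intro a; fun_prop
      have hB : ∀ a : ℝ≥0∞, Measurable fun y =>
          a ^ (q - 1) * ∑ n ∈ range N, h (n + 1) y := fun a => hS.const_mul _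
      calc ∫⁻ z, ∫⁻ y, (z.2 + h 0 y) ^ q ∂κ z.1 ∂ν
          ≤ ∫⁻ z, (z.2 ^ q + ENNReal.ofReal q *
              ∫⁻ y, (z.2 + h 0 y) ^ (q - 1) * h 0 y ∂κ z.1) ∂ν := by
            refine lintegral_mono fun z => ?_
            refine (lintegral_mono fun y => ENNReal_add_rpow_le hq z.2 (h 0 y)).trans ?_
            rw [lintegral_add_left measurable_const, lintegral_const_mul _ (hA _)]
            simp
        _ = ∫⁻ z, z.2 ^ q ∂ν + ENNReal.ofReal q *
              ∫⁻ z, ∫⁻ y, (z.2 + h 0 y) ^ (q - 1) * h 0 y ∂κ z.1 ∂ν := by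
            rw [lintegral_add_left (measurable_snd.pow_const q), lintegral_const_mul]
            exact Measurable.lintegral_kernel_prod_right
              (κ := κ.comap Prod.fst measurable_fst) hG
        _ ≤ ENNReal.ofReal q * ∫⁻ z, z.2 ^ (q - 1) * ∑ n ∈ range N, avg κ (h (n + 1)) z.1 ∂ν +
              ENNReal.ofReal q *
              ∫⁻ z, ∫⁻ y, (z.2 + h 0 y) ^ (q - 1) * h 0 y ∂κ z.1 ∂ν := by gcongr
        _ = ENNReal.ofReal q * ∫⁻ z, ((∫⁻ y, z.2 ^ (q - 1) * ∑ n ∈ range N, h (n + 1) y ∂κ z.1) +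
              ∫⁻ y, (z.2 + h 0 y) ^ (q - 1) * h 0 y ∂κ z.1) ∂ν := by
            rw [← mul_add, ← lintegral_add_left]
            · congr 1
              refine lintegral_congr fun z => ?_
              rw [lintegral_const_mul _ hS]
              congr 2
              exact (avg_sum κ (fun n => hh (n + 1)) N z.1).symm
            · refine (measurable_snd.pow_const _).mul ?_
              exact Finset.measurable_sum _ fun n _ =>
                (measurable_avg κ (hh _)).comp measurable_fst
        -- The old sum `z.2` is at most the new sum `z.2 + h 0 y`, so its power `q - 1` may be
        -- replaced by that of the new one.
        _ ≤ _ := by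
            gcongr with z
            rw [← lintegral_add_left (hB _)]
            refine lintegral_mono fun y => ?_
            simp only [Finset.sum_range_succ' _ N, mul_add]
            gcongr
            exact le_self_add
    · intro c hc
      have := h4 c fun n x => avg_le_const κ (hc _) x
      rw [stepMeasure, ae_map_iff (measurable_step h0).aemeasurable
        (measurableSet_le measurable_snd measurable_const)]
      refine Measure.ae_compProd_of_ae_ae
        (measurableSet_le (measurable_snd.comp (measurable_step h0)) measurable_const) ?_
      filter_upwards [this] with z hz
      refine Filter.Eventually.of_forall fun y => ?_
      simp only [Nat.cast_add, Nat.cast_one, add_mul, one_mul]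
      exact add_le_add hz (hc 0 y)

end GenOU

end

/-! ### Rota's maximal inequality by duality -/

noncomputable section

namespace GenOU

open ProbabilityTheory Finset

variable {X : Type*} [MeasurableSpace X]

/-- Division by `A ^ (1 / p)`. Finiteness of `A` is what makes this legitimate, and is the reason
for treating bounded functions first. -/
theorem rpow_le_of_le_mul_rpow {p q : ℝ} (hpq : p.HolderConjugate q) {A c : ℝ≥0∞} (hA : A ≠ ∞)
    (h : A ≤ c * A ^ (1 / p)) : A ^ (1 / q) ≤ c := by
  rcases eq_or_ne A 0 with rfl | h0
  · simp [hpq.symm.pos]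
  have e : A = A ^ (1 / q) * A ^ (1 / p) := by
    rw [← ENNReal.rpow_add _ _ h0 hA, one_div, one_div, add_comm, hpq.inv_add_inv_eq_one,
      ENNReal.rpow_one]
  have hp0 : A ^ (1 / p) ≠ 0 := by simp [h0, hA]
  have hpt : A ^ (1 / p) ≠ ∞ := ENNReal.rpow_ne_top_of_nonneg (by simpa using hpq.pos.le) hA
  rw [← ENNReal.mul_le_mul_iff_left hp0 hpt, ← e]
  exact h

/-- The left side is the expectation of `S φ(X_0)` for the chain of `exists_chain_measure`. Hölder
reduces it to `‖S‖_q`, and a second use of Hölder in the third property of that chain bounds this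
norm by `q ‖∑ h_n‖_q`. -/
theorem lintegral_sum_avg_mul_le {κ : Kernel X X} [IsMarkovKernel κ] {π : Measure X}
    [IsFiniteMeasure π] (hs : IsSymmetricKernel κ π) {p q : ℝ} (hpq : p.HolderConjugate q) (N : ℕ)
    {h : ℕ → X → ℝ≥0∞} (hh : ∀ n, Measurable (h n)) {c : ℝ≥0∞} (hc : c ≠ ∞)
    (hhc : ∀ n x, h n x ≤ c) {φ : X → ℝ≥0∞} (hφ : Measurable φ) :
    ∫⁻ x, (∑ n ∈ range N, (avg κ)^[2 * n] (h n) x) * φ x ∂π ≤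
      ENNReal.ofReal q * (∫⁻ x, (∑ n ∈ range N, h n x) ^ q ∂π) ^ (1 / q) *
        (∫⁻ x, φ x ^ p ∂π) ^ (1 / p) := by
  obtain ⟨ν, hν, h1, h2, h3, h4⟩ := exists_chain_measure hs hpq.symm.lt.le N h hh
  have hH : Measurable fun x => ∑ n ∈ range N, h n x := Finset.measurable_sum _ fun n _ => hh n
  have hHf : Measurable fun z : X × ℝ≥0∞ => ∑ n ∈ range N, h n z.1 := hH.comp measurable_fst
  have hmass : ν Set.univ = π Set.univ := by
    simpa using h1 (fun _ => 1) measurable_const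
  have hfin : ∫⁻ z, z.2 ^ q ∂ν ≠ ∞ := by
    have : ∫⁻ z, z.2 ^ q ∂ν ≤ ∫⁻ _, (N * c) ^ q ∂ν := by
      refine lintegral_mono_ae ?_
      filter_upwards [h4 c hhc] with z hz
      exact ENNReal.rpow_le_rpow hz hpq.symm.nonneg
    refine ne_top_of_le_ne_top ?_ this
    rw [lintegral_const, hmass]
    exact ENNReal.mul_ne_top (ENNReal.rpow_ne_top_of_nonneg hpq.symm.nonneg
      (ENNReal.mul_ne_top (ENNReal.natCast_ne_top N) hc)) (measure_ne_top π _)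
  have hA : (∫⁻ z, z.2 ^ q ∂ν) ^ (1 / q) ≤
      ENNReal.ofReal q * (∫⁻ x, (∑ n ∈ range N, h n x) ^ q ∂π) ^ (1 / q) := by
    refine rpow_le_of_le_mul_rpow hpq hfin (h3.trans ?_)
    rw [mul_assoc]
    gcongr
    refine (ENNReal.lintegral_mul_le_Lp_mul_Lq ν hpq
      (measurable_snd.pow_const (q - 1)).aemeasurable hHf.aemeasurable).trans_eq ?_
    rw [mul_comm, h1 (fun x => (∑ n ∈ range N, h n x) ^ q) (hH.pow_const q)]
    congr 3
    ext z
    rw [← ENNReal.rpow_mul, show (q - 1) * p = q by rw [hpq.symm.sub_one_mul_conj]]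
  rw [← h2 φ hφ]
  refine (ENNReal.lintegral_mul_le_Lp_mul_Lq ν hpq.symm measurable_snd.aemeasurable
    (hφ.comp measurable_fst).aemeasurable).trans ?_
  have := h1 (fun x => φ x ^ p) (hφ.pow_const p)
  simp only [Function.comp_apply]
  rw [this]
  gcongr

theorem measurable_range_sup (N : ℕ) {u : ℕ → X → ℝ≥0∞} (hu : ∀ n, Measurable (u n)) :
    Measurable fun x => (range N).sup fun n => u n x := by
  simp only [Finset.sup_eq_iSup]
  exact Measurable.iSup fun n => Measurable.iSup fun _ => hu n

/-- A maximum of finitely many functions, integrated against `g`, is linearized by splitting `g`. -/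
theorem exists_linearization (N : ℕ) {u : ℕ → X → ℝ≥0∞} (hu : ∀ n, Measurable (u n))
    {g : X → ℝ≥0∞} (hg : Measurable g) :
    ∃ h : ℕ → X → ℝ≥0∞, (∀ n, Measurable (h n)) ∧ (∀ n x, h n x ≤ g x) ∧
      (∀ x, ∑ n ∈ range N, h n x ≤ g x) ∧
      ∀ x, g x * (range N).sup (fun n => u n x) ≤ ∑ n ∈ range N, h n x * u n x := by
  induction N with
  | zero => exact ⟨fun _ _ => 0, fun _ => measurable_const, by simp, by simp, by simp⟩
  | succ N ih =>
    obtain ⟨h, h1, h2, h3, h4⟩ := ih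
    have hS : Measurable fun x => (range N).sup fun n => u n x := measurable_range_sup N hu
    have hE : MeasurableSet {x | (range N).sup (fun n => u n x) < u N x} :=
      measurableSet_lt hS (hu N)
    classical
    -- At a point where `u N` strictly exceeds the earlier maximum, all of `g` is given to `N`;
    -- elsewhere the previous splitting is kept.
    refine ⟨fun n x => if (range N).sup (fun n => u n x) < u N x then
      (if n = N then g x else 0) else (if n = N then 0 else h n x), fun n => ?_, fun n x => ?_,
      fun x => ?_, fun x => ?_⟩
    · refine Measurable.ite hE ?_ ?_ <;> split_ifs <;> first | assumption | exact h1 n | fun_prop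
    · dsimp only; split_ifs <;> simp [h2]
    all_goals
      have hne : ∀ n ∈ range N, n ≠ N := fun n hn => (Finset.mem_range.1 hn).ne
      rw [Finset.sum_range_succ]
      by_cases hx : (range N).sup (fun n => u n x) < u N x
    · simp only [hx, if_true]
      rw [Finset.sum_eq_zero fun n hn => if_neg (hne n hn)]
      simp
    · simp only [hx, if_false, if_true, add_zero]
      rw [Finset.sum_congr rfl fun n hn => if_neg (hne n hn)]
      exact h3 x
    · simp only [hx, if_true]
      rw [Finset.range_add_one, Finset.sup_insert, sup_of_le_left hx.le]
      exact le_add_self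
    · simp only [hx, if_false, if_true, zero_mul, add_zero]
      rw [Finset.sum_congr rfl fun n hn => by rw [if_neg (hne n hn)], Finset.range_add_one,
        Finset.sup_insert, sup_of_le_right (not_lt.1 hx)]
      exact h4 x

/-- With `M` the maximum and `M^{p-1}` split into the `h n`, symmetry moves the averages onto the `h
n`. Since `(p - 1) q = p`, the dual inequality bounds the integral of `M^p` by `q ‖f‖_p` times its
own power `1 / q`, which is then divided out. -/
theorem lintegral_sup_avg_rpow_le_of_bounded {κ : Kernel X X} [IsMarkovKernel κ] {π : Measure X}
    [IsFiniteMeasure π] (hs : IsSymmetricKernel κ π) {p q : ℝ} (hpq : p.HolderConjugate q) (N : ℕ)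
    {f : X → ℝ≥0∞} (hf : Measurable f) {c : ℝ≥0∞} (hc : c ≠ ∞) (hfc : ∀ x, f x ≤ c) :
    ∫⁻ x, (range N).sup (fun n => (avg κ)^[2 * n] f x) ^ p ∂π ≤
      ENNReal.ofReal q ^ p * ∫⁻ x, f x ^ p ∂π := by
  have hu : ∀ n, Measurable ((avg κ)^[2 * n] f) := fun n => measurable_avg_iterate κ hf _
  set M : X → ℝ≥0∞ := fun x => (range N).sup (fun n => (avg κ)^[2 * n] f x) with hM
  have hMm : Measurable M := measurable_range_sup N hu
  have hMc : ∀ x, M x ≤ c := fun x => Finset.sup_le fun n _ => avg_iterate_le_const κ hfc _ x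
  have hp1 : 0 < p - 1 := hpq.sub_one_pos
  obtain ⟨h, h1, h2, h3, h4⟩ := exists_linearization N hu (hMm.pow_const (p - 1))
  have hcp : c ^ (p - 1) ≠ ∞ := ENNReal.rpow_ne_top_of_nonneg hp1.le hc
  have hfin : ∫⁻ x, M x ^ p ∂π ≠ ∞ := by
    have : ∫⁻ x, M x ^ p ∂π ≤ ∫⁻ _, c ^ p ∂π :=
      lintegral_mono fun x => ENNReal.rpow_le_rpow (hMc x) hpq.nonneg
    refine ne_top_of_le_ne_top ?_ this
    rw [lintegral_const]
    exact ENNReal.mul_ne_top (ENNReal.rpow_ne_top_of_nonneg hpq.nonneg hc) (measure_ne_top π _)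
  have key : ∫⁻ x, M x ^ p ∂π ≤
      ENNReal.ofReal q * (∫⁻ x, f x ^ p ∂π) ^ (1 / p) * (∫⁻ x, M x ^ p ∂π) ^ (1 / q) := by
    calc ∫⁻ x, M x ^ p ∂π = ∫⁻ x, M x ^ (p - 1) * M x ∂π := by
          refine lintegral_congr fun x => ?_
          conv_rhs => rw [← ENNReal.rpow_one (M x), ← ENNReal.rpow_mul, one_mul]
          rw [← ENNReal.rpow_add_of_nonneg _ _ hp1.le zero_le_one, sub_add_cancel]
      _ ≤ ∫⁻ x, ∑ n ∈ range N, h n x * (avg κ)^[2 * n] f x ∂π := lintegral_mono h4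
      _ = ∫⁻ x, (∑ n ∈ range N, (avg κ)^[2 * n] (h n) x) * f x ∂π := by
          simp only [Finset.sum_mul]
          rw [lintegral_finsetSum (f := fun n x => h n x * (avg κ)^[2 * n] f x) _
            fun n _ => (h1 n).mul (hu n),
            lintegral_finsetSum (f := fun n x => (avg κ)^[2 * n] (h n) x * f x) _
            fun n _ => (measurable_avg_iterate κ (h1 n) _).mul hf]
          exact Finset.sum_congr rfl fun n _ => (hs.iterate (2 * n) (h1 n) hf).symm
      _ ≤ _ := lintegral_sum_avg_mul_le hs hpq N h1 hcp
          (fun n x => (h2 n x).trans (ENNReal.rpow_le_rpow (hMc x) hp1.le)) hf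
      _ ≤ ENNReal.ofReal q * (∫⁻ x, M x ^ p ∂π) ^ (1 / q) * (∫⁻ x, f x ^ p ∂π) ^ (1 / p) := by
          gcongr with x
          · exact one_div_nonneg.2 hpq.symm.nonneg
          · refine (ENNReal.rpow_le_rpow (h3 x) hpq.symm.nonneg).trans_eq ?_
            rw [← ENNReal.rpow_mul, hpq.sub_one_mul_conj]
      _ = _ := by ring
  have := ENNReal.rpow_le_rpow (rpow_le_of_le_mul_rpow hpq.symm hfin key) hpq.nonneg
  rwa [← ENNReal.rpow_mul, ENNReal.mul_rpow_of_nonneg _ _ hpq.nonneg, ← ENNReal.rpow_mul,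
    one_div_mul_cancel hpq.ne_zero, ENNReal.rpow_one, ENNReal.rpow_one] at this

/-- The maximal inequality of Rota for the even powers of a symmetric Markov operator. -/
theorem lintegral_sup_avg_rpow_le {κ : Kernel X X} [IsMarkovKernel κ] {π : Measure X}
    [IsFiniteMeasure π] (hs : IsSymmetricKernel κ π) {p q : ℝ} (hpq : p.HolderConjugate q) (N : ℕ)
    {f : X → ℝ≥0∞} (hf : Measurable f) :
    ∫⁻ x, (range N).sup (fun n => (avg κ)^[2 * n] f x) ^ p ∂π ≤
      ENNReal.ofReal q ^ p * ∫⁻ x, f x ^ p ∂π := by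
  -- The truncations of `f` increase to `f`, and the constant does not depend on the level.
  set F : ℕ → X → ℝ≥0∞ := fun m x => min (f x) m with hF
  have hFm : ∀ m, Measurable (F m) := fun m => hf.min measurable_const
  have hmono : Monotone F := fun i j hij x => min_le_min le_rfl (by exact_mod_cast hij)
  have hsup : f = fun x => ⨆ m, F m x := by
    ext x
    simp only [hF]
    rw [← inf_iSup_eq, ENNReal.iSup_natCast, inf_top_eq]
  have hu : ∀ m n, Measurable ((avg κ)^[2 * n] (F m)) :=
    fun m n => measurable_avg_iterate κ (hFm m) _
  have e : ∀ x, (range N).sup (fun n => (avg κ)^[2 * n] f x) ^ p =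
      ⨆ m, (range N).sup (fun n => (avg κ)^[2 * n] (F m) x) ^ p := by
    intro x
    have h1 : (range N).sup (fun n => (avg κ)^[2 * n] f x) =
        ⨆ m, (range N).sup (fun n => (avg κ)^[2 * n] (F m) x) := by
      conv_lhs => rw [hsup]
      simp only [Finset.sup_eq_iSup, avg_iterate_iSup κ hFm hmono]
      rw [iSup_comm]
      refine iSup_congr fun n => ?_
      rw [iSup_comm]
    rw [h1]
    exact (ENNReal.orderIsoRpow p hpq.pos).map_iSup _
  simp only [e]
  rw [lintegral_iSup]
  · refine iSup_le fun m => ?_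
    refine (lintegral_sup_avg_rpow_le_of_bounded hs hpq N (hFm m) (ENNReal.natCast_ne_top m)
      fun x => min_le_right _ _).trans ?_
    gcongr with x
    · exact hpq.nonneg
    · exact min_le_left _ _
  · intro m
    exact (measurable_range_sup N (hu m)).pow_const p
  · intro i j hij x
    refine ENNReal.rpow_le_rpow (Finset.sup_mono_fun fun n _ => ?_) hpq.nonneg
    exact avg_iterate_mono κ (hmono hij) _ x

end GenOU

end

noncomputable section

namespace GenOU

open Finset

/-! ### Series -/

theorem Gamma_natCast_add_pos {a : ℝ} (ha : 0 < a) (n : ℕ) : 0 < Real.Gamma (n + a) :=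
  Real.Gamma_pos_of_pos (by positivity)

theorem Gamma_succ_add {a : ℝ} (ha : 0 < a) (n : ℕ) :
    Real.Gamma ((n + 1 : ℕ) + a) = (n + a) * Real.Gamma (n + a) := by
  rw [← Real.Gamma_add_one (by positivity)]
  push_cast
  ring_nf

theorem ascPochhammer_eval_mul_Gamma {a : ℝ} (ha : 0 < a) (n : ℕ) :
    (ascPochhammer ℝ n).eval a * Real.Gamma a = Real.Gamma (n + a) := by
  induction n with
  | zero => simp
  | succ n ih =>
    rw [Gamma_succ_add ha, ← ih, ascPochhammer_succ_right]
    simp only [Polynomial.eval_mul, Polynomial.eval_add, Polynomial.eval_X,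
      Polynomial.eval_natCast]
    ring

theorem hasSum_binomial {b r : ℝ} (hb : 0 < b) (hr : |r| < 1) :
    HasSum (fun m : ℕ => Real.Gamma (m + b) / (Real.Gamma b * m.factorial) * r ^ m)
      ((1 - r) ^ (-b)) := by
  have h := (Real.one_div_one_sub_rpow_hasFPowerSeriesOnBall_zero b).hasSum (y := r)
    (by simpa [enorm_eq_nnnorm] using! hr)
  have hr1 : 0 ≤ 1 - r := by linarith [(abs_lt.1 hr).2]
  rw [zero_add, one_div, ← Real.rpow_neg hr1] at h
  convert! h using 1
  ext m
  have hne : Real.Gamma b ≠ 0 := (Real.Gamma_pos_of_pos hb).ne'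
  have hfac : (m.factorial : ℝ) ≠ 0 := by positivity
  have hc : Ring.choose (b + m - 1) m * m.factorial = (ascPochhammer ℝ m).eval b := by
    have := Ring.factorial_nsmul_multichoose_eq_ascPochhammer b m
    rw [Polynomial.ascPochhammer_smeval_eq_eval] at this
    rw [← this, nsmul_eq_mul, mul_comm, Ring.choose]
    congr 2
    ring
  rw [← ascPochhammer_eval_mul_Gamma hb, ← hc]
  simp
  field_simp

theorem summable_of_summable_antidiagonal {F : ℕ × ℕ → ℝ}
    (h : Summable fun n => ∑ kl ∈ antidiagonal n, |F kl|) : Summable F := by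
  rw [← summable_abs_iff, ← HasAntidiagonal.sigmaAntidiagonalEquivProd.summable_iff]
  refine (summable_sigma_of_nonneg fun x => abs_nonneg _).2 ⟨fun n => ?_, ?_⟩
  · exact (hasSum_fintype _).summable
  · refine h.congr fun n => ?_
    rw [tsum_fintype]
    exact (Finset.sum_coe_sort (antidiagonal n) fun kl => |F kl|).symm

/-- Summation of a double series by rows and by antidiagonals; used for the generating function and
for the Hille-Hardy formula. -/
theorem hasSum_antidiagonal {F : ℕ × ℕ → ℝ} (hF : Summable F) {g : ℕ → ℝ}
    (hg : ∀ k, HasSum (fun m => F (k, m)) (g k)) :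
    HasSum (fun n => ∑ kl ∈ antidiagonal n, F kl) (∑' k, g k) ∧ Summable g := by
  have h1 := hF.hasSum.prod_fiberwise hg
  refine ⟨?_, h1.summable⟩
  rw [h1.tsum_eq]
  have h2 := (HasAntidiagonal.sigmaAntidiagonalEquivProd.hasSum_iff).2 hF.hasSum
  refine h2.sigma fun n => ?_
  have := hasSum_fintype (fun c : antidiagonal n => F c)
  rw [Finset.sum_coe_sort (antidiagonal n) F] at this
  exact this

/-- Termwise differentiation of a power series. -/
theorem hasSum_deriv_of_hasSum {c : ℕ → ℝ} {f : ℝ → ℝ}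
    (H : ∀ r, |r| < 1 → HasSum (fun n => c n * r ^ n) (f r)) {r f' : ℝ} (hr : |r| < 1)
    (hf : HasDerivAt f f' r) : HasSum (fun n : ℕ => (n + 1) * c (n + 1) * r ^ n) f' := by
  obtain ⟨ρ, h1, h2⟩ := exists_between hr
  -- Convergence at `σ` bounds `c n * σ ^ n`, so the derivatives on the interval of radius `ρ < σ`
  -- are dominated by `n (ρ / σ)^n`.
  obtain ⟨σ, h3, h4⟩ := exists_between h2
  have hρ : 0 < ρ := (abs_nonneg r).trans_lt h1
  have hσ : 0 < σ := hρ.trans h3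
  have hs := (H σ (by rwa [abs_of_pos hσ])).summable
  obtain ⟨B, hB⟩ := hs.tendsto_atTop_zero.abs.bddAbove_range
  have hB' : ∀ n, |c n| * σ ^ n ≤ B := fun n => by
    have := hB ⟨n, rfl⟩
    simpa [abs_mul, abs_of_pos hσ] using this
  have hθ : ‖ρ / σ‖ < 1 := by
    rw [Real.norm_of_nonneg (by positivity), div_lt_one hσ]; exact h3
  have hu : Summable fun n : ℕ => B / ρ * ((n : ℝ) ^ 1 * (ρ / σ) ^ n) :=
    (summable_pow_mul_geometric_of_norm_lt_one 1 hθ).mul_left _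
  have hbd : ∀ (n : ℕ) (y : ℝ), y ∈ Set.Ioo (-ρ) ρ →
      ‖c n * (n * y ^ (n - 1))‖ ≤ B / ρ * ((n : ℝ) ^ 1 * (ρ / σ) ^ n) := by
    intro n y hy
    rcases n with _ | n
    · simp
    have hy' : |y| ≤ ρ := (abs_lt.2 hy).le
    have : ‖c (n + 1) * ((n + 1 : ℕ) * y ^ n)‖ ≤ |c (n + 1)| * ((n + 1 : ℕ) * ρ ^ n) := by
      rw [norm_mul, norm_mul, norm_pow, Real.norm_natCast]
      gcongr <;> simp [hy']
    refine this.trans ?_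
    have e : B / ρ * (((n + 1 : ℕ) : ℝ) ^ 1 * (ρ / σ) ^ (n + 1)) =
      B / σ ^ (n + 1) * ((n + 1 : ℕ) * ρ ^ n) := by
      rw [div_pow]; field_simp; ring
    rw [e]
    gcongr
    rw [le_div_iff₀ (by positivity)]
    exact hB' _
  have hr' : r ∈ Set.Ioo (-ρ) ρ := abs_lt.1 h1
  have hder := hasDerivAt_tsum_of_isPreconnected (g := fun n y => c n * y ^ n)
    (g' := fun n y => c n * (n * y ^ (n - 1))) hu isOpen_Ioo isPreconnected_Ioo
    (fun n y _ => (hasDerivAt_pow n y).const_mul (c n)) hbd hr'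
    (H r hr).summable hr'
  have hfe : f =ᶠ[nhds r] fun z => ∑' n, c n * z ^ n := by
    filter_upwards [isOpen_Ioo.mem_nhds hr'] with z hz
    exact (H z ((abs_lt.2 hz).trans h2)).tsum_eq.symm
  have hval := hf.unique (hder.congr_of_eventuallyEq hfe)
  have hsum : Summable fun n : ℕ => c n * (n * r ^ (n - 1)) :=
    Summable.of_norm_bounded hu fun n => hbd n r hr'
  have h5 := hsum.hasSum
  rw [← hval, hasSum_nat_add_iff' 1 |>.symm] at h5
  simpa [mul_comm, mul_left_comm, mul_assoc] using h5

/-- For `n ≥ 1` the ratio of successive left sides is at most `(n + 1) / n`, so growth is at most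
linear; the term `1 / Γ(a)` covers `n = 0`. The crude bound suffices against geometric decay. -/
theorem factorial_div_Gamma_le {a : ℝ} (ha : 0 < a) (n : ℕ) :
    n.factorial / Real.Gamma (n + a) ≤ 1 / Real.Gamma a + n / Real.Gamma (a + 1) := by
  have h1 : 0 < Real.Gamma a := Real.Gamma_pos_of_pos ha
  have h2 : 0 < Real.Gamma (a + 1) := Real.Gamma_pos_of_pos (by linarith)
  have key : ∀ n : ℕ, ((n + 1).factorial : ℝ) / Real.Gamma ((n + 1 : ℕ) + a) ≤
      (n + 1 : ℕ) / Real.Gamma (a + 1) := by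
    intro n
    induction n with
    | zero => simp [add_comm]
    | succ n ih =>
      rw [Gamma_succ_add ha, Nat.factorial_succ]
      have hg := Gamma_natCast_add_pos ha (n + 1)
      have hpos : (0 : ℝ) < (n + 1 : ℕ) + a := by positivity
      calc ((((n + 1 + 1) * (n + 1).factorial : ℕ) : ℝ)) /
            (((n + 1 : ℕ) + a) * Real.Gamma ((n + 1 : ℕ) + a))
          = ((n + 1 + 1 : ℕ) : ℝ) / ((n + 1 : ℕ) + a) *
            (((n + 1).factorial : ℝ) / Real.Gamma ((n + 1 : ℕ) + a)) := by
            push_cast; field_simp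
        _ ≤ ((n + 1 + 1 : ℕ) : ℝ) / ((n + 1 : ℕ) + a) * ((n + 1 : ℕ) / Real.Gamma (a + 1)) := by
            gcongr
        _ = ((n + 1 + 1 : ℕ) : ℝ) / Real.Gamma (a + 1) * ((n + 1 : ℕ) / ((n + 1 : ℕ) + a)) := by
            ring
        _ ≤ ((n + 1 + 1 : ℕ) : ℝ) / Real.Gamma (a + 1) * 1 := by
            gcongr
            rw [div_le_one hpos]; linarith
        _ = _ := mul_one _
  rcases n with _ | n
  · simp
  · exact (key n).trans (by have := one_div_pos.2 h1; linarith)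

theorem summable_pow_div_Gamma {a : ℝ} (ha : 0 < a) (z : ℝ) :
    Summable fun k : ℕ => z ^ k / Real.Gamma (k + a) := by
  rw [← summable_abs_iff]
  have hs : Summable fun k : ℕ => 1 / Real.Gamma a * (|z| ^ k / k.factorial) +
      1 / Real.Gamma (a + 1) * ((2 * |z|) ^ k / k.factorial) :=
    ((Real.summable_pow_div_factorial _).mul_left _).add
      ((Real.summable_pow_div_factorial _).mul_left _)
  refine Summable.of_nonneg_of_le (fun k => abs_nonneg _) (fun k => ?_) hs
  have hg := Gamma_natCast_add_pos ha k
  have h2 : 0 < Real.Gamma (a + 1) := Real.Gamma_pos_of_pos (by linarith)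
  have hk : (0 : ℝ) < k.factorial := by positivity
  rw [abs_div, abs_of_pos hg, abs_pow]
  calc |z| ^ k / Real.Gamma (k + a) = |z| ^ k / k.factorial *
        (k.factorial / Real.Gamma (k + a)) := by field_simp
    _ ≤ |z| ^ k / k.factorial * (1 / Real.Gamma a + k / Real.Gamma (a + 1)) := by
        gcongr; exact factorial_div_Gamma_le ha k
    _ ≤ |z| ^ k / k.factorial * (1 / Real.Gamma a + 2 ^ k / Real.Gamma (a + 1)) := by
        gcongr
        exact_mod_cast (Nat.lt_two_pow_self (n := k)).le
    _ = _ := by rw [mul_pow]; ring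

theorem summable_bessel {a : ℝ} (ha : 0 < a) (z : ℝ) :
    Summable fun k : ℕ => z ^ k / (k.factorial * Real.Gamma (k + a)) := by
  rw [← summable_abs_iff]
  refine Summable.of_nonneg_of_le (fun k => abs_nonneg _) (fun k => ?_)
    (summable_abs_iff.2 (summable_pow_div_Gamma ha z))
  have hg := Gamma_natCast_add_pos ha k
  have hk : (1 : ℝ) ≤ k.factorial := by
    exact_mod_cast Nat.one_le_iff_ne_zero.2 (Nat.factorial_ne_zero k)
  rw [abs_div, abs_div, abs_of_pos hg, abs_of_pos (mul_pos (by linarith) hg)]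
  gcongr
  exact le_mul_of_one_le_left hg.le hk

/-- The entire function `∑ zᵏ / (k! Γ(k + a))`, a normalized modified Bessel function. -/
def besselSeries (a z : ℝ) : ℝ := ∑' k : ℕ, z ^ k / (k.factorial * Real.Gamma (k + a))

end GenOU

end

noncomputable section

namespace GenOU

open Finset

/-! ### Laguerre polynomials -/

theorem laguerre_eq_sum (a : ℝ) (n : ℕ) (x : ℝ) :
    laguerre (a - 1) n x = Real.Gamma (n + a) * ∑ k ∈ range (n + 1),
      (-x) ^ k / (Real.Gamma (k + a) * k.factorial * (n - k).factorial) := by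
  rw [laguerre, Finset.mul_sum]
  refine Finset.sum_congr rfl fun k _ => ?_
  rw [show (n : ℝ) + (a - 1) + 1 = n + a by ring, show (k : ℝ) + (a - 1) + 1 = k + a by ring,
    neg_pow x]
  simp only [div_eq_mul_inv, mul_inv]
  ring

theorem abs_laguerre_le {a : ℝ} (ha : 0 < a) (n : ℕ) (x : ℝ) :
    |laguerre (a - 1) n x| ≤ laguerre (a - 1) n (-|x|) := by
  rw [laguerre_eq_sum, laguerre_eq_sum, abs_mul, abs_of_pos (Gamma_natCast_add_pos ha n)]
  refine mul_le_mul_of_nonneg_left ?_ (Gamma_natCast_add_pos ha n).le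
  refine (Finset.abs_sum_le_sum_abs _ _).trans (Finset.sum_le_sum fun k _ => ?_)
  have := Gamma_natCast_add_pos ha k
  rw [abs_div, abs_pow, abs_neg, neg_neg, abs_of_pos (a := _ * _) (by positivity)]

/-- The generating function: expand the exponential in `k` and each resulting power of `1 - r` by
the binomial series in `m`; the terms with `k + m = n` make up the `n`-th Laguerre polynomial. -/
theorem hasSum_laguerre {a r : ℝ} (ha : 0 < a) (hr : |r| < 1) (x : ℝ) :
    HasSum (fun n => laguerre (a - 1) n x * r ^ n)
      ((1 - r) ^ (-a) * Real.exp (-x * r / (1 - r))) := by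
  let F : ℝ → ℝ → ℕ × ℕ → ℝ := fun x r km => (-x * r) ^ km.1 / km.1.factorial *
    (Real.Gamma (km.2 + (km.1 + a)) / (Real.Gamma (km.1 + a) * km.2.factorial) * r ^ km.2)
  have hrow : ∀ x r : ℝ, |r| < 1 → ∀ k, HasSum (fun m => F x r (k, m))
      ((-x * r) ^ k / k.factorial * (1 - r) ^ (-(k + a))) := fun x r hr k =>
    (hasSum_binomial (b := k + a) (by positivity) hr).mul_left _
  have hval : ∀ x r : ℝ, |r| < 1 → ∀ k : ℕ, (-x * r) ^ k / k.factorial * (1 - r) ^ (-(k + a)) =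
      (1 - r) ^ (-a) * ((-x * r / (1 - r)) ^ k / k.factorial) := by
    intro x r hr k
    have h1 : 0 < 1 - r := by linarith [(abs_lt.1 hr).2]
    rw [neg_add, Real.rpow_add h1, Real.rpow_neg h1.le (k : ℝ), Real.rpow_natCast, div_pow]
    field_simp
  have hsum : Summable (F x r) := by
    rw [← summable_abs_iff]
    -- The absolute values form the same double series at `-|x|` and `|r|`, where all entries are
    -- nonnegative.
    have e : (fun km => |F x r km|) = F (-|x|) |r| := by
      ext ⟨k, m⟩
      have h1 := Gamma_natCast_add_pos ha k
      have h2 := Gamma_natCast_add_pos (a := k + a) (by positivity) m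
      simp only [F, abs_mul, abs_div, abs_pow, abs_neg, neg_neg, Nat.abs_cast, abs_of_pos h1,
        abs_of_pos h2]
    have hr' : |(|r|)| < 1 := by rwa [abs_abs]
    rw [e, summable_prod_of_nonneg]
    · refine ⟨fun k => (hrow _ _ hr' k).summable, ?_⟩
      simp only [(hrow _ _ hr' _).tsum_eq, hval _ _ hr']
      exact (Real.summable_pow_div_factorial _).mul_left _
    · rintro ⟨k, m⟩
      have h1 := Gamma_natCast_add_pos ha k
      have h2 := Gamma_natCast_add_pos (a := k + a) (by positivity) m
      simp only [F, neg_neg, Pi.zero_apply]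
      positivity
  have h := (hasSum_antidiagonal hsum (hrow x r hr)).1
  simp only [hval x r hr] at h
  rw [tsum_mul_left] at h
  have hexp : ∑' k : ℕ, (-x * r / (1 - r)) ^ k / k.factorial = Real.exp (-x * r / (1 - r)) := by
    rw [Real.exp_eq_exp_ℝ, NormedSpace.exp_eq_tsum_div]
  rw [hexp] at h
  convert! h using 1
  ext n
  rw [Finset.Nat.sum_antidiagonal_eq_sum_range_succ (fun k m => F x r (k, m)), laguerre_eq_sum,
    mul_assoc, Finset.sum_mul, Finset.mul_sum]
  refine Finset.sum_congr rfl fun k hk => ?_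
  have hkn : k ≤ n := Nat.lt_succ_iff.1 (Finset.mem_range.1 hk)
  have e1 : ((n - k : ℕ) : ℝ) + (k + a) = n + a := by
    rw [Nat.cast_sub hkn]; ring
  have e2 : r ^ n = r ^ k * r ^ (n - k) := by rw [← pow_add, Nat.add_sub_cancel' hkn]
  simp only [F]
  rw [e1, e2, mul_pow]
  have h1 := (Gamma_natCast_add_pos ha k).ne'
  have h2 := (Gamma_natCast_add_pos ha n).ne'
  field_simp

/-- This recurrence raises the degree when the generating function is differentiated in `r`. It
follows by comparing the coefficients `e j`. -/
theorem hasDerivAt_laguerre {a : ℝ} (ha : 0 < a) (k : ℕ) (u : ℝ) :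
    ∃ D, HasDerivAt (laguerre (a - 1) k) D u ∧
      (a + k - u) * laguerre (a - 1) k u + u * D = (k + 1) * laguerre (a - 1) (k + 1) u := by
  refine ⟨Real.Gamma (k + a) * ∑ j ∈ range (k + 1), (j * (-u) ^ (j - 1) * (-1)) /
      (Real.Gamma (j + a) * j.factorial * (k - j).factorial), ?_, ?_⟩
  · rw [show laguerre (a - 1) k = fun x => Real.Gamma (k + a) * ∑ j ∈ range (k + 1),
      (-x) ^ j / (Real.Gamma (j + a) * j.factorial * (k - j).factorial) from
      funext fun x => laguerre_eq_sum a k x]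
    refine HasDerivAt.const_mul _ (HasDerivAt.fun_sum fun j _ => ?_)
    exact ((hasDerivAt_neg u).pow j).div_const _
  · have hk := Gamma_natCast_add_pos ha k
    let e : ℕ → ℝ := fun j => (-u) ^ j / (Real.Gamma (j + a) * j.factorial)
    have he : ∀ j, u * e j = -((j + 1) * (j + a) * e (j + 1)) := by
      intro j
      have h1 := (Gamma_natCast_add_pos ha j).ne'
      have h2 : (j : ℝ) + a ≠ 0 := by positivity
      simp only [e]
      rw [Gamma_succ_add ha, Nat.factorial_succ]
      push_cast
      field_simp
      ring
    have hL : ∀ n, laguerre (a - 1) n u = Real.Gamma (n + a) *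
        ∑ j ∈ range (n + 1), e j / (n - j).factorial := by
      intro n
      rw [laguerre_eq_sum]
      simp only [e, div_div]
    have hD : u * (Real.Gamma (k + a) * ∑ j ∈ range (k + 1), (j * (-u) ^ (j - 1) * (-1)) /
        (Real.Gamma (j + a) * j.factorial * (k - j).factorial)) =
        Real.Gamma (k + a) * ∑ j ∈ range (k + 1), j * e j / (k - j).factorial := by
      rw [mul_left_comm, Finset.mul_sum]
      congr 1
      refine Finset.sum_congr rfl fun j _ => ?_
      rcases j with _ | j
      · simp
      · simp only [e, Nat.add_sub_cancel, pow_succ]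
        have h1 := (Gamma_natCast_add_pos ha (j + 1)).ne'
        field_simp
    have hU : u * ∑ j ∈ range (k + 1), e j / (k - j).factorial =
        -∑ j ∈ range (k + 2), j * (j - 1 + a) * e j / (k + 1 - j).factorial := by
      rw [Finset.sum_range_succ' _ (k + 1), Finset.mul_sum]
      simp only [Nat.cast_zero, zero_mul, zero_div, add_zero, Nat.add_sub_add_right]
      rw [← Finset.sum_neg_distrib]
      refine Finset.sum_congr rfl fun j _ => ?_
      rw [← mul_div_assoc, he]
      push_cast
      ring
    have hF : ∑ j ∈ range (k + 1), (a + k + j) * e j / (k - j).factorial =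
        ∑ j ∈ range (k + 2), (a + k + j) * (k + 1 - j) * e j / (k + 1 - j).factorial := by
      rw [Finset.sum_range_succ _ (k + 1)]
      push_cast
      simp only [sub_self, mul_zero, zero_mul, zero_div, add_zero]
      refine Finset.sum_congr rfl fun j hj => ?_
      have hjk : j ≤ k := Nat.lt_succ_iff.1 (Finset.mem_range.1 hj)
      have h1 : k + 1 - j = (k - j) + 1 := by omega
      have h2 : (k : ℝ) + 1 - j = ((k - j : ℕ) : ℝ) + 1 := by rw [Nat.cast_sub hjk]; ring
      rw [h1, Nat.factorial_succ, h2]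
      push_cast
      field_simp
    have hG : ∑ j ∈ range (k + 1), (a + k + j) * e j / (k - j).factorial =
        (a + k) * ∑ j ∈ range (k + 1), e j / (k - j).factorial +
          ∑ j ∈ range (k + 1), j * e j / (k - j).factorial := by
      rw [Finset.mul_sum, ← Finset.sum_add_distrib]
      exact Finset.sum_congr rfl fun j _ => by ring
    -- The identity behind this is `(k+1)(k+a) = (a+k+j)(k+1-j) + j(j-1+a)`.
    have hR : (k + 1) * (k + a) * ∑ j ∈ range (k + 2), e j / (k + 1 - j).factorial =
        ∑ j ∈ range (k + 2), (a + k + j) * (k + 1 - j) * e j / (k + 1 - j).factorial +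
        ∑ j ∈ range (k + 2), j * (j - 1 + a) * e j / (k + 1 - j).factorial := by
      rw [Finset.mul_sum, ← Finset.sum_add_distrib]
      exact Finset.sum_congr rfl fun j _ => by ring
    rw [hD, hL, hL, Gamma_succ_add ha]
    linear_combination Real.Gamma (k + a) * (-hU - hG + hF - hR)

/-- The `k`-th derivative in `r` of the generating function, divided by `k!`. In the induction the
product rule produces exactly the left side of the recurrence in `hasDerivAt_laguerre`, at `u = x /
(1 - r)`. -/
theorem hasSum_choose_laguerre {a : ℝ} (ha : 0 < a) (x : ℝ) (k : ℕ) :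
    ∀ r : ℝ, |r| < 1 →
    HasSum (fun m : ℕ => ((m + k).choose k * laguerre (a - 1) (m + k) x) * r ^ m)
      ((1 - r) ^ (-(a + k)) * Real.exp (-x * r / (1 - r)) * laguerre (a - 1) k (x / (1 - r))) := by
  induction k with
  | zero =>
    intro r hr
    have : laguerre (a - 1) 0 (x / (1 - r)) = 1 := by
      rw [laguerre_eq_sum]
      simp [(Real.Gamma_pos_of_pos ha).ne']
    simpa [this] using hasSum_laguerre ha hr x
  | succ k ih =>
    intro r hr
    have h1 : 0 < 1 - r := by linarith [(abs_lt.1 hr).2]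
    obtain ⟨D, hD, hrec⟩ := hasDerivAt_laguerre ha k (x / (1 - r))
    have hsub : HasDerivAt (fun r : ℝ => 1 - r) (-1) r := by
      simpa using (hasDerivAt_id r).const_sub 1
    have hA : HasDerivAt (fun r : ℝ => (1 - r) ^ (-(a + k)))
        ((a + k) * ((1 - r) ^ (-(a + k)) / (1 - r))) r := by
      convert hsub.rpow_const (p := -(a + k)) (Or.inl h1.ne') using 1
      rw [Real.rpow_sub_one h1.ne']
      ring
    have hB0 : HasDerivAt (fun r : ℝ => -x * r / (1 - r)) (-x / (1 - r) ^ 2) r := by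
      refine (((hasDerivAt_id r).const_mul (-x)).div hsub h1.ne').congr_deriv ?_
      simp only [id]
      ring
    have hC0 : HasDerivAt (fun r : ℝ => x / (1 - r)) (x / (1 - r) ^ 2) r := by
      refine ((hasDerivAt_const r x).div hsub h1.ne').congr_deriv ?_
      ring
    have hC := hD.comp r hC0
    have hder := (hA.mul hB0.exp).mul hC
    have h := hasSum_deriv_of_hasSum ih hr hder
    have h' := h.div_const ((k : ℝ) + 1)
    have hk : (k : ℝ) + 1 ≠ 0 := by positivity
    convert! h' using 1
    · ext m
      have hch : ((m + 1 + k).choose k : ℝ) * (m + 1) = (m + (k + 1)).choose (k + 1) * (k + 1) := by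
        have := Nat.choose_succ_right_eq (m + (k + 1)) k
        rw [show m + (k + 1) - k = m + 1 by omega] at this
        rw [show m + 1 + k = m + (k + 1) by ring]
        exact_mod_cast this.symm
      rw [show m + 1 + k = m + (k + 1) by ring] at hch ⊢
      rw [eq_div_iff hk]
      linear_combination -laguerre (a - 1) (m + (k + 1)) x * r ^ m * hch
    · rw [eq_div_iff hk]
      have e : (1 - r) ^ (-(a + (k + 1 : ℕ))) = (1 - r) ^ (-(a + k)) / (1 - r) := by
        rw [← Real.rpow_sub_one h1.ne']
        push_cast
        ring_nf
      rw [e]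
      simp only [Function.comp_apply, Pi.mul_apply]
      have hu : x / (1 - r) ^ 2 = x / (1 - r) / (1 - r) := by rw [div_div, sq]
      rw [neg_div, hu]
      generalize x / (1 - r) = u at *
      linear_combination -(1 - r) ^ (-(a + k)) / (1 - r) * Real.exp (-x * r / (1 - r)) * hrec

end GenOU

end

noncomputable section

namespace GenOU

open Finset

/-! ### The Hille-Hardy formula -/

/-- The terms of the kernel of the Laguerre semigroup of type `a - 1`. -/
def lagTerm (a q x y : ℝ) (n : ℕ) : ℝ :=
  n.factorial / Real.Gamma (n + a) * laguerre (a - 1) n x * laguerre (a - 1) n y * q ^ n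

/-- The kernel of the Laguerre semigroup of type `a - 1`. -/
def lagKernel (a q x y : ℝ) : ℝ := ∑' n, lagTerm a q x y n

theorem exists_laguerre_mul_pow_le {a s : ℝ} (ha : 0 < a) (hs0 : 0 ≤ s) (hs : s < 1) (x : ℝ) :
    ∃ B, ∀ n, laguerre (a - 1) n (-|x|) * s ^ n ≤ B := by
  have h := (hasSum_laguerre ha (by rwa [abs_of_nonneg hs0]) (-|x|)).summable
  obtain ⟨B, hB⟩ := h.tendsto_atTop_zero.bddAbove_range
  exact ⟨B, fun n => hB ⟨n, rfl⟩⟩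

theorem laguerre_neg_abs_nonneg {a : ℝ} (ha : 0 < a) (n : ℕ) (x : ℝ) :
    0 ≤ laguerre (a - 1) n (-|x|) := (abs_nonneg _).trans (abs_laguerre_le ha n x)

theorem summable_lagTerm_neg_abs {a q : ℝ} (ha : 0 < a) (hq0 : 0 ≤ q) (hq : q < 1) (x y : ℝ) :
    Summable (lagTerm a q (-|x|) (-|y|)) := by
  -- One cube root of `q` for each Laguerre factor, which it keeps bounded in `n`, and one to sum
  -- the linear growth of `n! / Γ(n + a)`.
  set s : ℝ := q ^ (1 / 3 : ℝ) with hs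
  have hs0 : 0 ≤ s := Real.rpow_nonneg hq0 _
  have hs1 : s < 1 := Real.rpow_lt_one hq0 hq (by norm_num)
  have hs3 : q = s * s * s := by
    have : s ^ 3 = q := by
      rw [hs, ← Real.rpow_natCast, ← Real.rpow_mul hq0]; norm_num
    rw [← this]; ring
  obtain ⟨B, hB⟩ := exists_laguerre_mul_pow_le ha hs0 hs1 x
  obtain ⟨B', hB'⟩ := exists_laguerre_mul_pow_le ha hs0 hs1 y
  have hL := laguerre_neg_abs_nonneg ha
  have hB0 : 0 ≤ B := (mul_nonneg (hL 0 x) (by positivity)).trans (hB 0)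
  have hB0' : 0 ≤ B' := (mul_nonneg (hL 0 y) (by positivity)).trans (hB' 0)
  have hn : ‖s‖ < 1 := by rwa [Real.norm_of_nonneg hs0]
  have hmaj : Summable fun n : ℕ => B * B' * (1 / Real.Gamma a * s ^ n +
      1 / Real.Gamma (a + 1) * ((n : ℝ) ^ 1 * s ^ n)) :=
    (((summable_geometric_of_lt_one hs0 hs1).mul_left _).add
      ((summable_pow_mul_geometric_of_norm_lt_one 1 hn).mul_left _)).mul_left _
  refine Summable.of_nonneg_of_le (fun n => ?_) (fun n => ?_) hmaj
  · have := Gamma_natCast_add_pos ha n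
    have h1 := hL n x
    have h2 := hL n y
    unfold lagTerm
    positivity
  · have hg := Gamma_natCast_add_pos ha n
    have hg1 := Real.Gamma_pos_of_pos ha
    have hg2 : 0 < Real.Gamma (a + 1) := Real.Gamma_pos_of_pos (by linarith)
    have h1 := hL n x
    have h2 := hL n y
    calc lagTerm a q (-|x|) (-|y|) n
        = (laguerre (a - 1) n (-|x|) * s ^ n) * (laguerre (a - 1) n (-|y|) * s ^ n) *
          (n.factorial / Real.Gamma (n + a) * s ^ n) := by
          rw [lagTerm, hs3, mul_pow, mul_pow]; ring
      _ ≤ B * B' * ((1 / Real.Gamma a + n / Real.Gamma (a + 1)) * s ^ n) := by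
          gcongr
          · exact hB n
          · exact hB' n
          · exact factorial_div_Gamma_le ha n
      _ = _ := by ring

theorem abs_lagTerm_le {a q : ℝ} (ha : 0 < a) (hq0 : 0 ≤ q) (x y : ℝ) (n : ℕ) :
    |lagTerm a q x y n| ≤ lagTerm a q (-|x|) (-|y|) n := by
  have hg := Gamma_natCast_add_pos ha n
  unfold lagTerm
  rw [abs_mul, abs_mul, abs_mul, abs_of_nonneg (a := q ^ n) (by positivity),
    abs_of_nonneg (a := _ / _) (by positivity)]
  gcongr
  · exact mul_nonneg (by positivity) (laguerre_neg_abs_nonneg ha n x)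
  · exact abs_laguerre_le ha n x
  · exact abs_laguerre_le ha n y

theorem summable_lagTerm {a q : ℝ} (ha : 0 < a) (hq0 : 0 ≤ q) (hq : q < 1) (x y : ℝ) :
    Summable (lagTerm a q x y) :=
  Summable.of_norm_bounded (summable_lagTerm_neg_abs ha hq0 hq x y) (abs_lagTerm_le ha hq0 x y)

/-- The Cauchy product of the exponential and Bessel series has the explicit Laguerre polynomial in
its `k`-th coefficient. -/
theorem tsum_laguerre_div_Gamma {a : ℝ} (ha : 0 < a) (u w : ℝ) :
    ∑' k : ℕ, w ^ k * laguerre (a - 1) k u / Real.Gamma (k + a) =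
      Real.exp w * besselSeries a (-u * w) := by
  have h1 : Summable fun k : ℕ => ‖w ^ k / (k.factorial : ℝ)‖ :=
    (Real.summable_pow_div_factorial w).norm
  have h2 := (summable_bessel ha (-u * w)).norm
  rw [besselSeries, Real.exp_eq_exp_ℝ, NormedSpace.exp_eq_tsum_div, mul_comm,
    tsum_mul_tsum_eq_tsum_sum_antidiagonal_of_summable_norm h2 h1]
  refine tsum_congr fun k => ?_
  rw [Finset.Nat.sum_antidiagonal_eq_sum_range_succ (fun i j =>
    (-u * w) ^ i / (i.factorial * Real.Gamma (i + a)) * (w ^ j / j.factorial)), laguerre_eq_sum,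
    mul_left_comm, mul_div_cancel_left₀ _ (Gamma_natCast_add_pos ha k).ne', Finset.mul_sum]
  refine Finset.sum_congr rfl fun j hj => ?_
  have hjk : j ≤ k := Nat.lt_succ_iff.1 (Finset.mem_range.1 hj)
  have e2 : w ^ k = w ^ j * w ^ (k - j) := by rw [← pow_add, Nat.add_sub_cancel' hjk]
  have := (Gamma_natCast_add_pos ha j).ne'
  rw [e2, mul_pow]
  field_simp

/-- The Hille-Hardy formula. -/
theorem lagKernel_eq {a q : ℝ} (ha : 0 < a) (hq0 : 0 ≤ q) (hq : q < 1) (x y : ℝ) :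
    lagKernel a q x y = (1 - q) ^ (-a) * Real.exp (-(q * (x + y) / (1 - q))) *
      besselSeries a (x * y * q / (1 - q) ^ 2) := by
  have h1 : 0 < 1 - q := by linarith
  have hqa : |q| < 1 := by rwa [abs_of_nonneg hq0]
  -- Writing out only the polynomial in `y` gives a double sum over `k ≤ n`. With `n = m + k`, the
  -- sum over `m` is a differentiated generating function and the remaining sum over `k` is a Bessel
  -- series.
  let F : ℕ × ℕ → ℝ := fun km => (-y * q) ^ km.1 / Real.Gamma (km.1 + a) *
    (((km.2 + km.1).choose km.1 * laguerre (a - 1) (km.2 + km.1) x) * q ^ km.2)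
  have hdiag : ∀ (n k : ℕ), k ∈ range (n + 1) → F (k, n - k) =
      n.factorial * laguerre (a - 1) n x * q ^ n *
        ((-y) ^ k / (Real.Gamma (k + a) * k.factorial * (n - k).factorial)) := by
    intro n k hk
    have hkn : k ≤ n := Nat.lt_succ_iff.1 (Finset.mem_range.1 hk)
    have e2 : q ^ n = q ^ k * q ^ (n - k) := by rw [← pow_add, Nat.add_sub_cancel' hkn]
    have := (Gamma_natCast_add_pos ha k).ne'
    simp only [F]
    rw [Nat.sub_add_cancel hkn, Nat.cast_choose ℝ hkn, e2, mul_pow]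
    field_simp
  have hF : Summable F := by
    refine summable_of_summable_antidiagonal ?_
    refine Summable.of_nonneg_of_le (fun n => Finset.sum_nonneg fun _ _ => abs_nonneg _)
      (fun n => ?_) (summable_lagTerm_neg_abs ha hq0 hq x y)
    rw [Finset.Nat.sum_antidiagonal_eq_sum_range_succ (fun k m => |F (k, m)|)]
    have hg := Gamma_natCast_add_pos ha n
    have hs : ∑ k ∈ range n.succ, |F (k, n - k)| =
        n.factorial / Real.Gamma (n + a) * |laguerre (a - 1) n x| *
          laguerre (a - 1) n (-|y|) * q ^ n := by
      rw [laguerre_eq_sum a n (-|y|), Finset.mul_sum, Finset.mul_sum, Finset.sum_mul]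
      refine Finset.sum_congr rfl fun k hk => ?_
      have := Gamma_natCast_add_pos ha k
      rw [hdiag n k hk, abs_mul, abs_mul, abs_mul, abs_div, abs_pow, abs_pow, abs_neg, neg_neg,
        abs_of_nonneg hq0, abs_of_pos (a := _ * _) (by positivity), Nat.abs_cast]
      field_simp
    rw [hs, lagTerm]
    gcongr
    · exact laguerre_neg_abs_nonneg ha n y
    · exact abs_laguerre_le ha n x
  have hrow : ∀ k : ℕ, HasSum (fun m => F (k, m)) ((1 - q) ^ (-a) *
      Real.exp (-x * q / (1 - q)) * ((-y * q / (1 - q)) ^ k *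
        laguerre (a - 1) k (x / (1 - q)) / Real.Gamma (k + a))) := by
    intro k
    have h := (hasSum_choose_laguerre ha x k q hqa).mul_left ((-y * q) ^ k / Real.Gamma (k + a))
    convert! h using 1
    rw [neg_add, Real.rpow_add h1, Real.rpow_neg h1.le (k : ℝ), Real.rpow_natCast, div_pow]
    have := (Gamma_natCast_add_pos ha k).ne'
    field_simp
  have h := (hasSum_antidiagonal hF hrow).1
  rw [tsum_mul_left, tsum_laguerre_div_Gamma ha] at h
  have hL : (fun n => ∑ kl ∈ antidiagonal n, F kl) = lagTerm a q x y := by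
    ext n
    rw [Finset.Nat.sum_antidiagonal_eq_sum_range_succ (fun k m => F (k, m)),
      Finset.sum_congr rfl (hdiag n), ← Finset.mul_sum, lagTerm, laguerre_eq_sum a n y]
    have := (Gamma_natCast_add_pos ha n).ne'
    field_simp
  rw [hL] at h
  rw [lagKernel, h.tsum_eq]
  have e1 : -(x / (1 - q)) * (-y * q / (1 - q)) = x * y * q / (1 - q) ^ 2 := by field_simp
  have e2 : -(q * (x + y) / (1 - q)) = -x * q / (1 - q) + -y * q / (1 - q) := by ring
  rw [e1, e2, Real.exp_add]
  ring

theorem besselSeries_nonneg {a z : ℝ} (ha : 0 < a) (hz : 0 ≤ z) : 0 ≤ besselSeries a z :=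
  tsum_nonneg fun k => by
    have := Gamma_natCast_add_pos ha k
    positivity

theorem lagKernel_nonneg {a q x y : ℝ} (ha : 0 < a) (hq0 : 0 ≤ q) (hq : q < 1) (hx : 0 ≤ x)
    (hy : 0 ≤ y) : 0 ≤ lagKernel a q x y := by
  have h1 : 0 < 1 - q := by linarith
  rw [lagKernel_eq ha hq0 hq]
  have := besselSeries_nonneg (a := a) (z := x * y * q / (1 - q) ^ 2) ha (by positivity)
  positivity

/-- The comparison `I_{a} ≤ C I_{a-1}` of modified Bessel functions. -/
theorem mul_besselSeries_succ_le {a : ℝ} (ha : 0 < a) (w : ℝ) :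
    w * besselSeries (a + 1) (w ^ 2) ≤ max 1 (1 / a) * besselSeries a (w ^ 2) := by
  set C := max 1 (1 / a) with hC
  have hC0 : 0 < C := lt_max_of_lt_left one_pos
  have hs := summable_bessel ha (w ^ 2)
  have hs' := summable_bessel (a := a + 1) (by linarith) (w ^ 2)
  set c : ℕ → ℝ := fun k => (w ^ 2) ^ k / (k.factorial * Real.Gamma (k + a)) with hc
  -- By `2 w ≤ (k + 1) + w² / (k + 1)`, each term lies below a combination of two neighbouring terms
  -- of the other series; `C` is chosen so that `k + 1 ≤ C (k + a)`.
  have hterm : ∀ k : ℕ, w * ((w ^ 2) ^ k / (k.factorial * Real.Gamma (k + (a + 1)))) ≤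
      C / 2 * c k + 1 / 2 * c (k + 1) := by
    intro k
    have hg := Gamma_natCast_add_pos ha k
    have hka : 0 < (k : ℝ) + a := by positivity
    have e0 : Real.Gamma (k + (a + 1)) = (k + a) * Real.Gamma (k + a) := by
      rw [← add_assoc, Real.Gamma_add_one hka.ne']
    have hCk : (k : ℝ) + 1 ≤ C * (k + a) := by
      have h1 : 1 ≤ C := le_max_left _ _
      have h2 : 1 ≤ C * a := by
        have := le_max_right 1 (1 / a)
        rw [← hC, div_le_iff₀ ha] at this
        exact this
      nlinarith [Nat.cast_nonneg (α := ℝ) k]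
    simp only [hc]
    rw [Gamma_succ_add ha, e0, Nat.factorial_succ, pow_succ (w ^ 2) k]
    push_cast
    have hk1 : (0 : ℝ) < k + 1 := by positivity
    have key : w ≤ C / 2 * (k + a) + 1 / 2 * (w ^ 2 / (k + 1)) := by
      have : 2 * w ≤ (k + 1) + w ^ 2 / (k + 1) := by
        rw [← sub_nonneg]
        have : (k : ℝ) + 1 + w ^ 2 / (k + 1) - 2 * w = (k + 1 - w) ^ 2 / (k + 1) := by
          field_simp; ring
        rw [this]; positivity
      linarith
    calc w * ((w ^ 2) ^ k / (k.factorial * ((k + a) * Real.Gamma (k + a))))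
        = (w ^ 2) ^ k / (k.factorial * ((k + a) * Real.Gamma (k + a))) * w := by ring
      _ ≤ (w ^ 2) ^ k / (k.factorial * ((k + a) * Real.Gamma (k + a))) *
          (C / 2 * (k + a) + 1 / 2 * (w ^ 2 / (k + 1))) := by gcongr
      _ = _ := by field_simp
  have hs1 : Summable fun k => c (k + 1) := (summable_nat_add_iff 1).2 hs
  have h0 : 0 ≤ c 0 := by
    have := Gamma_natCast_add_pos ha 0
    simp only [hc]; positivity
  have htail : ∑' k, c (k + 1) ≤ ∑' k, c k := by
    rw [hs.tsum_eq_zero_add]; linarith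
  have hb : besselSeries a (w ^ 2) = ∑' k, c k := rfl
  have hbn : 0 ≤ ∑' k, c k := hb ▸ besselSeries_nonneg ha (by positivity)
  calc w * besselSeries (a + 1) (w ^ 2)
      = ∑' k : ℕ, w * ((w ^ 2) ^ k / (k.factorial * Real.Gamma (k + (a + 1)))) := by
        rw [besselSeries, tsum_mul_left]
    _ ≤ ∑' k, (C / 2 * c k + 1 / 2 * c (k + 1)) :=
        (hs'.mul_left w).tsum_le_tsum hterm ((hs.mul_left _).add (hs1.mul_left _))
    _ = C / 2 * ∑' k, c k + 1 / 2 * ∑' k, c (k + 1) := by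
        rw [(hs.mul_left _).tsum_add (hs1.mul_left _), tsum_mul_left, tsum_mul_left]
    _ ≤ C / 2 * ∑' k, c k + C / 2 * ∑' k, c k := by
        have : (1 : ℝ) / 2 ≤ C / 2 := by
          have := le_max_left 1 (1 / a)
          linarith
        gcongr
    _ = C * besselSeries a (w ^ 2) := by rw [hb]; ring

/-- In the Hille-Hardy formula the type `a + 1` costs one more factor `1 / (1 - r²)`. With `w = |r x
y| / (1 - r²)` both Bessel arguments are `w²`, and the claim becomes `mul_besselSeries_succ_le`. -/
theorem abs_odd_lagKernel_le {a r : ℝ} (ha : 0 < a) (hr0 : 0 ≤ r) (hr : r < 1) (x y : ℝ) :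
    |r * x * y * lagKernel (a + 1) (r ^ 2) (x ^ 2) (y ^ 2)| ≤
      max 1 (1 / a) * lagKernel a (r ^ 2) (x ^ 2) (y ^ 2) := by
  have hq0 : 0 ≤ r ^ 2 := by positivity
  have hq : r ^ 2 < 1 := by nlinarith
  have h1 : 0 < 1 - r ^ 2 := by linarith
  rw [abs_mul, abs_of_nonneg (lagKernel_nonneg (by linarith) hq0 hq (sq_nonneg x) (sq_nonneg y)),
    lagKernel_eq (by linarith) hq0 hq, lagKernel_eq ha hq0 hq]
  set w := |r * x * y| / (1 - r ^ 2) with hw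
  have ew : x ^ 2 * y ^ 2 * r ^ 2 / (1 - r ^ 2) ^ 2 = w ^ 2 := by
    rw [hw, div_pow, sq_abs]; ring
  have ea : (1 - r ^ 2) ^ (-(a + 1)) = (1 - r ^ 2) ^ (-a) / (1 - r ^ 2) := by
    rw [← Real.rpow_sub_one h1.ne']; ring_nf
  rw [ew, ea]
  have := mul_besselSeries_succ_le ha w
  calc _ = (1 - r ^ 2) ^ (-a) * Real.exp (-(r ^ 2 * (x ^ 2 + y ^ 2) / (1 - r ^ 2))) *
        (w * besselSeries (a + 1) (w ^ 2)) := by rw [hw]; ring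
    _ ≤ (1 - r ^ 2) ^ (-a) * Real.exp (-(r ^ 2 * (x ^ 2 + y ^ 2) / (1 - r ^ 2))) *
        (max 1 (1 / a) * besselSeries a (w ^ 2)) := by gcongr
    _ = _ := by ring

/-- For fixed `x`, the kernel is bounded in `y`, locally uniformly in the time variable. -/
theorem lagKernel_le {a q q₁ x y : ℝ} (ha : 0 < a) (hq0 : 0 < q) (hqq : q ≤ q₁) (hq : q₁ < 1)
    (hx : 0 ≤ x) (hy : 0 ≤ y) :
    lagKernel a q x y ≤ (1 - q₁) ^ (-a) * ∑' k : ℕ, (x / (1 - q₁)) ^ k / Real.Gamma (k + a) := by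
  have h1 : 0 < 1 - q₁ := by linarith
  have h2 : 0 < 1 - q := by linarith
  rw [lagKernel_eq ha hq0.le (by linarith), mul_assoc]
  have hA : (1 - q) ^ (-a) ≤ (1 - q₁) ^ (-a) :=
    Real.rpow_le_rpow_of_nonpos h1 (by linarith) (by linarith)
  gcongr
  · exact mul_nonneg (Real.exp_pos _).le (besselSeries_nonneg ha (by positivity))
  rw [besselSeries, ← tsum_mul_left]
  refine ((summable_bessel ha _).mul_left _).tsum_le_tsum (fun k => ?_)
    (summable_pow_div_Gamma ha _)
  have hg := Gamma_natCast_add_pos ha k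
  -- The decay `exp (-s)` absorbs `s ^ k / k!` in every term, which removes `y`.
  set s := q * y / (1 - q) with hs
  have hs0 : 0 ≤ s := by positivity
  have hexp : s ^ k / k.factorial ≤ Real.exp s := Real.pow_div_factorial_le_exp s hs0 k
  have hE : Real.exp (-(q * (x + y) / (1 - q))) ≤ Real.exp (-s) := by
    refine Real.exp_le_exp.2 (neg_le_neg ?_)
    rw [hs]; gcongr; linarith
  calc Real.exp (-(q * (x + y) / (1 - q))) *
        ((x * y * q / (1 - q) ^ 2) ^ k / (k.factorial * Real.Gamma (k + a)))
      ≤ Real.exp (-s) * ((x * y * q / (1 - q) ^ 2) ^ k / (k.factorial * Real.Gamma (k + a))) := by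
        gcongr
    _ = Real.exp (-s) * (s ^ k / k.factorial) * ((x / (1 - q)) ^ k / Real.Gamma (k + a)) := by
        have : x * y * q / (1 - q) ^ 2 = s * (x / (1 - q)) := by rw [hs]; field_simp
        rw [this, mul_pow]; field_simp
    _ ≤ Real.exp (-s) * Real.exp s * ((x / (1 - q₁)) ^ k / Real.Gamma (k + a)) := by
        gcongr
    _ = _ := by rw [← Real.exp_add]; simp

end GenOU

end

noncomputable section

namespace GenOU

open Finset

/-! ### Orthogonality -/

theorem integral_pow_lam {μ : ℝ} (hμ : -(1 / 2) < μ) (k : ℕ) :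
    ∫ x, (x ^ 2) ^ k ∂(lam μ) = Real.Gamma (k + (μ + 1 / 2)) := by
  have hm : Measurable fun x : ℝ => ENNReal.ofReal (|x| ^ (2 * μ) * Real.exp (-x ^ 2)) := by
    fun_prop
  rw [lam, integral_withDensity_eq_integral_toReal_smul hm (by simp)]
  have h1 : ∫ x : ℝ, (ENNReal.ofReal (|x| ^ (2 * μ) * Real.exp (-x ^ 2))).toReal • (x ^ 2) ^ k =
      ∫ x : ℝ, (fun y : ℝ => y ^ (2 * μ + 2 * k) * Real.exp (-y ^ (2 : ℝ))) |x| := by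
    refine integral_congr_ae ?_
    have h0 : ∀ᵐ x : ℝ, x ≠ 0 := by
      simp [ae_iff]
    filter_upwards [h0] with x hx
    have hx' : 0 < |x| := abs_pos.2 hx
    rw [ENNReal.toReal_ofReal (by positivity), Real.rpow_add hx', Real.rpow_two, sq_abs,
      smul_eq_mul, ← sq_abs x, ← pow_mul, ← Real.rpow_natCast |x| (2 * k)]
    push_cast
    ring
  rw [h1, integral_comp_abs (f := fun y : ℝ => y ^ (2 * μ + 2 * k) * Real.exp (-y ^ (2 : ℝ))),
    integral_rpow_mul_exp_neg_rpow (by norm_num)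
    (by have := Nat.cast_nonneg (α := ℝ) k; linarith)]
  rw [show (2 * μ + 2 * (k : ℝ) + 1) / 2 = k + (μ + 1 / 2) by ring]
  ring

theorem integrable_pow_lam {μ : ℝ} (hμ : -(1 / 2) < μ) (k : ℕ) :
    Integrable (fun x => (x ^ 2) ^ k) (lam μ) := by
  -- The Bochner integral of a non-integrable function is `0`, so the nonzero Gamma value proves
  -- integrability.
  refine Integrable.of_integral_ne_zero ?_
  rw [integral_pow_lam hμ]
  exact (Gamma_natCast_add_pos (by linarith) k).ne'

theorem isFiniteMeasure_lam {μ : ℝ} (hμ : -(1 / 2) < μ) : IsFiniteMeasure (lam μ) := by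
  have := integrable_pow_lam hμ 0
  simp only [pow_zero] at this
  exact (integrable_const_iff_isFiniteMeasure one_ne_zero).1 this

theorem integrable_laguerre_mul_pow {μ : ℝ} (hμ : -(1 / 2) < μ) (a : ℝ) (n j : ℕ) :
    Integrable (fun x => laguerre (a - 1) n (x ^ 2) * (x ^ 2) ^ j) (lam μ) := by
  simp only [laguerre_eq_sum, mul_assoc, Finset.sum_mul]
  refine Integrable.const_mul (integrable_finsetSum _ fun k _ => ?_) _
  have := (integrable_pow_lam hμ (k + j)).const_mul
    ((-1) ^ k / (Real.Gamma (k + a) * (k.factorial * (n - k).factorial)))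
  convert! this using 2 with x
  rw [neg_pow (x ^ 2), pow_add]
  ring

theorem integrable_laguerre_mul_laguerre {μ : ℝ} (hμ : -(1 / 2) < μ) (a : ℝ) (n m : ℕ) :
    Integrable (fun x => laguerre (a - 1) n (x ^ 2) * laguerre (a - 1) m (x ^ 2)) (lam μ) := by
  simp only [laguerre_eq_sum a m, Finset.mul_sum]
  refine integrable_finsetSum _ fun k _ => ?_
  have := (integrable_laguerre_mul_pow hμ a n k).const_mul
    (Real.Gamma (m + a) * ((-1) ^ k / (Real.Gamma (k + a) * k.factorial * (m - k).factorial)))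
  convert! this using 2 with x
  rw [neg_pow (x ^ 2)]
  ring

/-- Up to the factor `(-1)^n / n!`, this is the `n`-th finite difference of a monic polynomial of
degree `j`. -/
theorem sum_neg_one_pow_mul_ascPochhammer (a : ℝ) {n j : ℕ} (hj : j ≤ n) :
    ∑ k ∈ range (n + 1), (-1) ^ k / (k.factorial * (n - k).factorial) *
      (ascPochhammer ℝ j).eval (k + a) = if j = n then (-1) ^ n else 0 := by
  have h := fwdDiff_iter_eq_sum_shift (1 : ℝ) (ascPochhammer ℝ j).eval n a
  have e : ∑ k ∈ range (n + 1), (-1 : ℝ) ^ k / (k.factorial * (n - k).factorial) *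
      (ascPochhammer ℝ j).eval (k + a) =
      (-1) ^ n / n.factorial * (fwdDiff (1 : ℝ))^[n] (ascPochhammer ℝ j).eval a := by
    rw [h, Finset.mul_sum]
    refine Finset.sum_congr rfl fun k hk => ?_
    have hkn : k ≤ n := Nat.lt_succ_iff.1 (Finset.mem_range.1 hk)
    have e1 : (-1 : ℝ) ^ n * (-1) ^ (n - k) = (-1) ^ k := by
      rw [← pow_add, ← Nat.sub_add_cancel hkn, Nat.add_sub_cancel, add_right_comm, pow_add]
      rw [Even.neg_one_pow (by simp), one_mul]
    rw [nsmul_one, zsmul_eq_mul, add_comm a]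
    push_cast
    rw [Nat.cast_choose ℝ hkn, ← e1]
    field_simp
  rw [e]
  split_ifs with hjn
  · subst hjn
    have := congrFun (Polynomial.fwdDiff_iter_degree_eq_factorial (ascPochhammer ℝ j)) a
    rw [ascPochhammer_natDegree, (monic_ascPochhammer ℝ j).leadingCoeff, one_smul] at this
    rw [this]
    have : (j.factorial : ℝ) ≠ 0 := by positivity
    simp [this]
  · have hlt : (ascPochhammer ℝ j).natDegree < n := by
      rw [ascPochhammer_natDegree]; omega
    rw [Polynomial.fwdDiff_iter_eq_zero_of_degree_lt hlt]
    simp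

/-- The moment `Γ(k + j + a)` is a rising factorial of `k + a` times `Γ(k + a)`, which cancels the
denominator of the Laguerre coefficient and leaves an `n`-th finite difference. -/
theorem integral_laguerre_mul_pow {μ a : ℝ} (hμ : -(1 / 2) < μ) (ha : a = μ + 1 / 2) {n j : ℕ}
    (hj : j ≤ n) :
    ∫ x, laguerre (a - 1) n (x ^ 2) * (x ^ 2) ^ j ∂(lam μ) =
      if j = n then (-1) ^ n * Real.Gamma (n + a) else 0 := by
  have ha0 : 0 < a := by linarith
  have hterm : ∀ k : ℕ, ∫ x, (-(x ^ 2)) ^ k / (Real.Gamma (k + a) * k.factorial *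
      (n - k).factorial) * (x ^ 2) ^ j ∂(lam μ) =
      (-1) ^ k / (k.factorial * (n - k).factorial) * (ascPochhammer ℝ j).eval (k + a) := by
    intro k
    have hg := (Gamma_natCast_add_pos ha0 k).ne'
    have h1 := ascPochhammer_eval_mul_Gamma (a := k + a) (by positivity) j
    have h2 := integral_pow_lam hμ (k + j)
    rw [← ha, show ((k + j : ℕ) : ℝ) + a = j + (k + a) by push_cast; ring, ← h1] at h2
    have e : ∀ x : ℝ, (-(x ^ 2)) ^ k / (Real.Gamma (k + a) * k.factorial *
      (n - k).factorial) * (x ^ 2) ^ j = (-1) ^ k / (Real.Gamma (k + a) * k.factorial *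
      (n - k).factorial) * (x ^ 2) ^ (k + j) := by
      intro x
      rw [neg_pow (x ^ 2), pow_add]
      ring
    simp only [e]
    rw [integral_const_mul, h2]
    field_simp
  have hint : ∀ k : ℕ, Integrable (fun x => (-(x ^ 2)) ^ k / (Real.Gamma (k + a) * k.factorial *
      (n - k).factorial) * (x ^ 2) ^ j) (lam μ) := by
    intro k
    have := (integrable_pow_lam hμ (k + j)).const_mul
      ((-1) ^ k / (Real.Gamma (k + a) * (k.factorial * (n - k).factorial)))
    convert! this using 2 with x
    rw [neg_pow (x ^ 2), pow_add]
    ring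
  simp only [laguerre_eq_sum, mul_assoc (Real.Gamma _) (∑ _ ∈ _, _), Finset.sum_mul]
  rw [integral_const_mul, integral_finsetSum _ fun k _ => hint k,
    Finset.sum_congr rfl fun k _ => hterm k, sum_neg_one_pow_mul_ascPochhammer a hj]
  split_ifs <;> ring

theorem integral_laguerre_mul_laguerre {μ a : ℝ} (hμ : -(1 / 2) < μ) (ha : a = μ + 1 / 2)
    (n m : ℕ) :
    ∫ x, laguerre (a - 1) n (x ^ 2) * laguerre (a - 1) m (x ^ 2) ∂(lam μ) =
      if n = m then Real.Gamma (n + a) / n.factorial else 0 := by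
  have ha0 : 0 < a := by linarith
  wlog hmn : m ≤ n generalizing n m
  · have := this m n (by omega)
    simp only [mul_comm (laguerre (a - 1) n _)]
    rw [this]
    by_cases h : n = m
    · simp [h]
    · simp [h, Ne.symm h]
  have hint : ∀ k : ℕ, Integrable (fun x => laguerre (a - 1) n (x ^ 2) * (Real.Gamma (m + a) *
      ((-(x ^ 2)) ^ k / (Real.Gamma (k + a) * k.factorial * (m - k).factorial)))) (lam μ) := by
    intro k
    have := (integrable_laguerre_mul_pow hμ a n k).const_mul
      (Real.Gamma (m + a) * ((-1) ^ k / (Real.Gamma (k + a) * k.factorial * (m - k).factorial)))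
    convert! this using 2 with x
    rw [neg_pow (x ^ 2)]
    ring
  have hterm : ∀ k ∈ range (m + 1), ∫ x, laguerre (a - 1) n (x ^ 2) * (Real.Gamma (m + a) *
      ((-(x ^ 2)) ^ k / (Real.Gamma (k + a) * k.factorial * (m - k).factorial))) ∂(lam μ) =
      if k = n then Real.Gamma (n + a) / n.factorial else 0 := by
    intro k hk
    have hkm : k ≤ m := Nat.lt_succ_iff.1 (Finset.mem_range.1 hk)
    have e : ∀ x : ℝ, laguerre (a - 1) n (x ^ 2) * (Real.Gamma (m + a) *
      ((-(x ^ 2)) ^ k / (Real.Gamma (k + a) * k.factorial * (m - k).factorial))) =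
      (Real.Gamma (m + a) * ((-1) ^ k / (Real.Gamma (k + a) * k.factorial *
        (m - k).factorial))) * (laguerre (a - 1) n (x ^ 2) * (x ^ 2) ^ k) := by
      intro x
      rw [neg_pow (x ^ 2)]
      ring
    simp only [e]
    rw [integral_const_mul, integral_laguerre_mul_pow hμ ha (hkm.trans hmn)]
    split_ifs with h
    · subst h
      obtain rfl : k = m := le_antisymm hkm hmn
      have hg := (Gamma_natCast_add_pos ha0 k).ne'
      have : ((-1 : ℝ) ^ k) * (-1) ^ k = 1 := by rw [← mul_pow]; simp
      simp only [Nat.sub_self, Nat.factorial_zero, Nat.cast_one, mul_one]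
      field_simp
      linear_combination this
    · simp
  simp only [laguerre_eq_sum a m, Finset.mul_sum]
  rw [integral_finsetSum _ fun k _ => hint k, Finset.sum_congr rfl hterm, Finset.sum_ite_eq']
  by_cases h : n = m
  · simp [h]
  · rw [if_neg h, if_neg]
    simp only [Finset.mem_range]
    omega

theorem summable_sqrt_mul_laguerre {a q : ℝ} (ha : 0 < a) (hq0 : 0 ≤ q) (hq : q < 1) (x : ℝ) :
    Summable fun n : ℕ =>
      √(n.factorial / Real.Gamma (n + a)) * |laguerre (a - 1) n x| * q ^ n := by
  refine Summable.of_nonneg_of_le (fun n => by positivity) (fun n => ?_)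
    (((summable_lagTerm ha hq0 hq x x).add (summable_geometric_of_lt_one hq0 hq)).mul_left (1 / 2))
  have hg := Gamma_natCast_add_pos ha n
  set c := √(n.factorial / Real.Gamma (n + a)) with hc
  have hc2 : n.factorial / Real.Gamma (n + a) = c ^ 2 := (Real.sq_sqrt (by positivity)).symm
  rw [lagTerm, hc2, ← sq_abs, mul_assoc (_ ^ 2) (laguerre _ _ _), ← sq, ← sq_abs (laguerre _ _ _)]
  rw [sq_abs c]
  have hqn : 0 ≤ q ^ n := by positivity
  nlinarith [mul_nonneg hqn (sq_nonneg (c * |laguerre (a - 1) n x| - 1))]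

/-- The Chapman-Kolmogorov equation for the Laguerre kernels. -/
theorem integral_lagKernel_mul_lagKernel {μ a q s : ℝ} (hμ : -(1 / 2) < μ) (ha : a = μ + 1 / 2)
    (hq0 : 0 ≤ q) (hq : q < 1) (hs0 : 0 ≤ s) (hs : s < 1) (x z : ℝ) :
    ∫ y, lagKernel a q x (y ^ 2) * lagKernel a s (y ^ 2) z ∂(lam μ) = lagKernel a (q * s) x z := by
  have ha0 : 0 < a := by linarith
  let c : ℕ → ℝ := fun n => √(n.factorial / Real.Gamma (n + a))
  have hc : ∀ n : ℕ, n.factorial / Real.Gamma (n + a) = c n * c n := fun n =>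
    (Real.mul_self_sqrt (by have := Gamma_natCast_add_pos ha0 n; positivity)).symm
  have hc0 : ∀ n, 0 ≤ c n := fun n => Real.sqrt_nonneg _
  let F : ℕ × ℕ → ℝ → ℝ := fun p y => lagTerm a q x (y ^ 2) p.1 * lagTerm a s (y ^ 2) z p.2
  have hF : ∀ p y, F p y = (c p.1 * laguerre (a - 1) p.1 x * q ^ p.1) *
      (c p.2 * laguerre (a - 1) p.2 z * s ^ p.2) *
      (c p.1 * c p.2 * (laguerre (a - 1) p.1 (y ^ 2) * laguerre (a - 1) p.2 (y ^ 2))) := by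
    intro p y
    simp only [F, lagTerm, hc]
    ring
  have hint : ∀ p, Integrable (F p) (lam μ) := by
    intro p
    rw [show F p = _ from funext (hF p)]
    exact ((integrable_laguerre_mul_laguerre hμ a _ _).const_mul _).const_mul _
  -- The functions `c n * laguerre (a - 1) n (y ^ 2)` are orthonormal, so `2 |u v| ≤ u² + v²` bounds
  -- these integrals by one.
  have hone : ∀ n m, ∫ y, c n * c m * |laguerre (a - 1) n (y ^ 2) * laguerre (a - 1) m (y ^ 2)|
      ∂(lam μ) ≤ 1 := by
    intro n m
    have hL := fun n => (integrable_laguerre_mul_laguerre hμ a n n).const_mul (1 / 2 * (c n * c n))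
    have hI : ∀ n, ∫ y, 1 / 2 * (c n * c n) * (laguerre (a - 1) n (y ^ 2) *
        laguerre (a - 1) n (y ^ 2)) ∂(lam μ) = 1 / 2 := by
      intro n
      rw [integral_const_mul, integral_laguerre_mul_laguerre hμ ha, if_pos rfl, ← hc]
      have := (Gamma_natCast_add_pos ha0 n).ne'
      field_simp
    calc _ ≤ ∫ y, 1 / 2 * (c n * c n) * (laguerre (a - 1) n (y ^ 2) * laguerre (a - 1) n (y ^ 2)) +
          1 / 2 * (c m * c m) * (laguerre (a - 1) m (y ^ 2) * laguerre (a - 1) m (y ^ 2))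
            ∂(lam μ) := by
          refine integral_mono (((integrable_laguerre_mul_laguerre hμ a n m).abs).const_mul _)
            ((hL n).add (hL m)) fun y => ?_
          dsimp only [Pi.add_apply]
          rw [abs_mul]
          have := sq_nonneg (c n * |laguerre (a - 1) n (y ^ 2)| - c m * |laguerre (a - 1) m (y ^ 2)|)
          have e1 := abs_mul_abs_self (laguerre (a - 1) n (y ^ 2))
          have e2 := abs_mul_abs_self (laguerre (a - 1) m (y ^ 2))
          rw [← e1, ← e2]
          nlinarith
      _ = 1 := by rw [integral_add (hL n) (hL m), hI, hI]; norm_num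
  have hsum : Summable fun p => ∫ y, ‖F p y‖ ∂(lam μ) := by
    have h1 := summable_sqrt_mul_laguerre ha0 hq0 hq x
    have h2 := summable_sqrt_mul_laguerre ha0 hs0 hs z
    refine Summable.of_nonneg_of_le (fun p => integral_nonneg fun _ => norm_nonneg _) (fun p => ?_)
      (h1.mul_of_nonneg h2 (fun n => by positivity) fun n => by positivity)
    have e : ∀ y, ‖F p y‖ = (c p.1 * |laguerre (a - 1) p.1 x| * q ^ p.1) *
      (c p.2 * |laguerre (a - 1) p.2 z| * s ^ p.2) *
      (c p.1 * c p.2 * |laguerre (a - 1) p.1 (y ^ 2) * laguerre (a - 1) p.2 (y ^ 2)|) := by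
      intro y
      rw [hF, Real.norm_eq_abs]
      simp only [abs_mul, abs_of_nonneg (hc0 _), abs_pow, abs_of_nonneg hq0, abs_of_nonneg hs0]
    simp only [e]
    rw [integral_const_mul]
    refine mul_le_of_le_one_right ?_ (hone _ _)
    have := hc0 p.1
    have := hc0 p.2
    positivity
  have h := hasSum_integral_of_summable_integral_norm hint hsum
  have hprod : ∀ y, ∑' p, F p y = lagKernel a q x (y ^ 2) * lagKernel a s (y ^ 2) z := by
    intro y
    rw [lagKernel, lagKernel, tsum_mul_tsum_of_summable_norm (summable_lagTerm ha0 hq0 hq _ _).norm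
      (summable_lagTerm ha0 hs0 hs _ _).norm]
  simp only [hprod] at h
  have hval : ∀ p : ℕ × ℕ, ∫ y, F p y ∂(lam μ) =
      if p.2 = p.1 then lagTerm a (q * s) x z p.1 else 0 := by
    intro p
    simp only [hF]
    rw [integral_const_mul, integral_const_mul, integral_laguerre_mul_laguerre hμ ha]
    by_cases hp : p.1 = p.2
    · rw [if_pos hp, if_pos hp.symm, lagTerm, ← hp, mul_pow]
      have hg := (Gamma_natCast_add_pos ha0 p.1).ne'
      have hcc : c p.1 * c p.1 * (Real.Gamma (p.1 + a) / p.1.factorial) = 1 := by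
        rw [← hc]; field_simp
      rw [hcc, hc]
      ring
    · rw [if_neg hp, if_neg (Ne.symm hp)]; simp
  simp only [hval] at h
  have hrow := h.prod_fiberwise fun n => hasSum_ite_eq n (lagTerm a (q * s) x z n)
  exact hrow.tsum_eq.symm

theorem integral_lagKernel {μ a q : ℝ} (hμ : -(1 / 2) < μ) (ha : a = μ + 1 / 2)
    (hq0 : 0 ≤ q) (hq : q < 1) (x : ℝ) :
    ∫ y, lagKernel a q x (y ^ 2) ∂(lam μ) = 1 := by
  have ha0 : 0 < a := by linarith
  have hg := (Real.Gamma_pos_of_pos ha0).ne'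
  -- At parameter `0` only the term `n = 0` survives, so the second kernel is the constant `1 /
  -- Γ(a)` and the semigroup law becomes mass one.
  have h := integral_lagKernel_mul_lagKernel hμ ha hq0 hq le_rfl one_pos x 0
  have h0 : ∀ u v, lagKernel a 0 u v = 1 / Real.Gamma a := by
    intro u v
    have hL : ∀ w, laguerre (a - 1) 0 w = 1 := fun w => by
      rw [laguerre_eq_sum]; simp [hg]
    rw [lagKernel, tsum_eq_single 0]
    · simp [lagTerm, hL]
    · intro n hn
      simp [lagTerm, hn]
  rw [mul_zero, h0] at h
  simp only [h0] at h
  rw [integral_mul_const] at h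
  exact mul_right_cancel₀ (one_div_ne_zero hg) (by rw [h, one_mul])

end GenOU

end

noncomputable section

namespace GenOU

open Finset ProbabilityTheory

/-! ### The kernel of the generalized Ornstein-Uhlenbeck semigroup -/

theorem kernelTerm_even {μ : ℝ} (hμ : -(1 / 2) < μ) (t x y : ℝ) (m : ℕ) :
    kernelTerm μ t x y (2 * m) =
      lagTerm (μ + 1 / 2) (Real.exp (-t) ^ 2) (x ^ 2) (y ^ 2) m := by
  have h1 := (Real.Gamma_pos_of_pos (by linarith : 0 < μ + 1 / 2)).ne'
  have h2 := (Gamma_natCast_add_pos (by linarith : 0 < μ + 1 / 2) m).ne'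
  have e : Real.exp (-((2 * m : ℕ) * t)) = (Real.exp (-t) ^ 2) ^ m := by
    rw [← pow_mul, ← Real.exp_nat_mul]; congr 1; push_cast; ring
  have hs : ((-1 : ℝ) ^ m) * (-1) ^ m = 1 := by rw [← mul_pow]; simp
  rw [kernelTerm, genFactorial, genHermite, genHermite, lagTerm, if_pos (even_two_mul m),
    if_pos (even_two_mul m), if_pos (even_two_mul m), Nat.mul_div_cancel_left m two_pos, e,
    show μ + 1 / 2 - 1 = μ - 1 / 2 by ring, show (m : ℝ) + μ + 1 / 2 = m + (μ + 1 / 2) by ring]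
  have h3 : ((2 * m).factorial : ℝ) ≠ 0 := by positivity
  generalize laguerre (μ - 1 / 2) m (x ^ 2) = A
  generalize laguerre (μ - 1 / 2) m (y ^ 2) = B
  generalize Real.Gamma (m + (μ + 1 / 2)) = G at *
  generalize Real.Gamma (μ + 1 / 2) = G₀ at *
  generalize (Real.exp (-t) ^ 2) ^ m = E
  generalize ((2 * m).factorial : ℝ) = N at *
  generalize (-1 : ℝ) ^ m = s at *
  field_simp
  linear_combination (A * B * E) * hs

theorem kernelTerm_odd {μ : ℝ} (hμ : -(1 / 2) < μ) (t x y : ℝ) (m : ℕ) :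
    kernelTerm μ t x y (2 * m + 1) = Real.exp (-t) * x * y *
      lagTerm (μ + 1 / 2 + 1) (Real.exp (-t) ^ 2) (x ^ 2) (y ^ 2) m := by
  have h1 := (Real.Gamma_pos_of_pos (by linarith : 0 < μ + 1 / 2)).ne'
  have h2 := (Gamma_natCast_add_pos (by linarith : 0 < μ + 1 / 2 + 1) m).ne'
  have e : Real.exp (-((2 * m + 1 : ℕ) * t)) = Real.exp (-t) * (Real.exp (-t) ^ 2) ^ m := by
    rw [← pow_mul, ← Real.exp_nat_mul, ← Real.exp_add]; congr 1; push_cast; ring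
  have hs : ((-1 : ℝ) ^ m) * (-1) ^ m = 1 := by rw [← mul_pow]; simp
  have hodd : ¬ Even (2 * m + 1) := by simp
  rw [kernelTerm, genFactorial, genHermite, genHermite, lagTerm, if_neg hodd,
    if_neg hodd, if_neg hodd, show (2 * m + 1) / 2 = m by omega, e,
    show μ + 1 / 2 + 1 - 1 = μ + 1 / 2 by ring,
    show (m : ℝ) + μ + 3 / 2 = m + (μ + 1 / 2 + 1) by ring]
  have h3 : ((2 * m + 1).factorial : ℝ) ≠ 0 := by positivity
  generalize laguerre (μ + 1 / 2) m (x ^ 2) = A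
  generalize laguerre (μ + 1 / 2) m (y ^ 2) = B
  generalize Real.Gamma (m + (μ + 1 / 2 + 1)) = G at *
  generalize Real.Gamma (μ + 1 / 2) = G₀ at *
  generalize (Real.exp (-t) ^ 2) ^ m = E
  generalize ((2 * m + 1).factorial : ℝ) = N at *
  generalize (-1 : ℝ) ^ m = s at *
  field_simp
  linear_combination (x * A * y * B * E) * hs

/-- The even part of the kernel. -/
def evenKernel (μ t x y : ℝ) : ℝ := lagKernel (μ + 1 / 2) (Real.exp (-t) ^ 2) (x ^ 2) (y ^ 2)

theorem exp_neg_lt_one {t : ℝ} (ht : 0 < t) : Real.exp (-t) < 1 := by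
  rw [Real.exp_lt_one_iff]; linarith

theorem exp_neg_sq_lt_one {t : ℝ} (ht : 0 < t) : Real.exp (-t) ^ 2 < 1 := by
  have := exp_neg_lt_one ht
  have := Real.exp_pos (-t)
  nlinarith

theorem hasSum_kernelTerm {μ t : ℝ} (hμ : -(1 / 2) < μ) (ht : 0 < t) (x y : ℝ) :
    HasSum (kernelTerm μ t x y) (evenKernel μ t x y + Real.exp (-t) * x * y *
      lagKernel (μ + 1 / 2 + 1) (Real.exp (-t) ^ 2) (x ^ 2) (y ^ 2)) := by
  have hq := exp_neg_sq_lt_one ht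
  refine HasSum.even_add_odd ?_ ?_
  · simp only [kernelTerm_even hμ]
    exact (summable_lagTerm (by linarith) (by positivity) hq _ _).hasSum
  · simp only [kernelTerm_odd hμ]
    exact (summable_lagTerm (by linarith) (by positivity) hq _ _).hasSum.mul_left _

theorem kernel_eq {μ t : ℝ} (hμ : -(1 / 2) < μ) (ht : 0 < t) (x y : ℝ) :
    kernel μ t x y = evenKernel μ t x y + Real.exp (-t) * x * y *
      lagKernel (μ + 1 / 2 + 1) (Real.exp (-t) ^ 2) (x ^ 2) (y ^ 2) :=
  (hasSum_kernelTerm hμ ht x y).tsum_eq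

theorem evenKernel_nonneg {μ t : ℝ} (hμ : -(1 / 2) < μ) (ht : 0 < t) (x y : ℝ) :
    0 ≤ evenKernel μ t x y :=
  lagKernel_nonneg (by linarith) (by positivity) (exp_neg_sq_lt_one ht) (sq_nonneg x) (sq_nonneg y)

/-- The `1` in the constant comes from the even part and the maximum from the odd part. -/
theorem abs_kernel_le {μ t : ℝ} (hμ : -(1 / 2) < μ) (ht : 0 < t) (x y : ℝ) :
    |kernel μ t x y| ≤ (1 + max 1 (1 / (μ + 1 / 2))) * evenKernel μ t x y := by
  rw [kernel_eq hμ ht, add_mul, one_mul]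
  refine (abs_add_le _ _).trans (add_le_add (abs_of_nonneg (evenKernel_nonneg hμ ht x y)).le ?_)
  exact abs_odd_lagKernel_le (by linarith) (Real.exp_pos _).le (exp_neg_lt_one ht) x y

theorem lagKernel_comm (a q x y : ℝ) : lagKernel a q x y = lagKernel a q y x :=
  tsum_congr fun n => by simp only [lagTerm]; ring

theorem evenKernel_comm (μ t x y : ℝ) : evenKernel μ t x y = evenKernel μ t y x :=
  lagKernel_comm _ _ _ _

theorem exists_evenKernel_le {μ t₀ : ℝ} (hμ : -(1 / 2) < μ) (ht₀ : 0 < t₀) (x : ℝ) :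
    ∃ M : ℝ, ∀ t, t₀ ≤ t → ∀ y, evenKernel μ t x y ≤ M := by
  refine ⟨_, fun t ht y => lagKernel_le (by linarith) (by positivity) ?_ (exp_neg_sq_lt_one ht₀)
    (sq_nonneg x) (sq_nonneg y)⟩
  have := Real.exp_le_exp.2 (neg_le_neg ht)
  gcongr

theorem continuous_laguerre (α : ℝ) (n : ℕ) : Continuous (laguerre α n) := by
  unfold laguerre
  fun_prop

theorem measurable_lagKernel {a q : ℝ} (ha : 0 < a) (hq0 : 0 ≤ q) (hq : q < 1) :
    Measurable fun z : ℝ × ℝ => lagKernel a q z.1 z.2 := by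
  have hterm : ∀ n, Measurable fun z : ℝ × ℝ => lagTerm a q z.1 z.2 n := fun n => by
    have h1 := continuous_laguerre (a - 1) n
    unfold lagTerm
    fun_prop
  refine measurable_of_tendsto_metrizable
    (f := fun (N : ℕ) (z : ℝ × ℝ) => ∑ n ∈ range N, lagTerm a q z.1 z.2 n)
    (fun N => Finset.measurable_sum _ fun n _ => hterm n) ?_
  exact tendsto_pi_nhds.2 fun z => (summable_lagTerm ha hq0 hq z.1 z.2).hasSum.tendsto_sum_nat

theorem measurable_lagKernel_sq {a q : ℝ} (ha : 0 < a) (hq0 : 0 ≤ q) (hq : q < 1) :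
    Measurable fun z : ℝ × ℝ => lagKernel a q (z.1 ^ 2) (z.2 ^ 2) :=
  Measurable.comp (g := fun z : ℝ × ℝ => lagKernel a q z.1 z.2)
    (f := fun z : ℝ × ℝ => (z.1 ^ 2, z.2 ^ 2)) (measurable_lagKernel ha hq0 hq) (by fun_prop)

theorem measurable_evenKernel {μ t : ℝ} (hμ : -(1 / 2) < μ) (ht : 0 < t) :
    Measurable fun z : ℝ × ℝ => evenKernel μ t z.1 z.2 :=
  measurable_lagKernel_sq (by linarith) (by positivity) (exp_neg_sq_lt_one ht)

theorem measurable_kernel {μ t : ℝ} (hμ : -(1 / 2) < μ) (ht : 0 < t) :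
    Measurable fun z : ℝ × ℝ => kernel μ t z.1 z.2 := by
  simp only [kernel_eq hμ ht]
  have h1 := measurable_evenKernel hμ ht
  have h2 := measurable_lagKernel_sq (a := μ + 1 / 2 + 1) (by linarith) (by positivity)
    (exp_neg_sq_lt_one ht)
  fun_prop

theorem continuousAt_lagKernel {a q : ℝ} (ha : 0 < a) (hq0 : 0 < q) (hq : q < 1) (x y : ℝ) :
    ContinuousAt (fun q => lagKernel a q x y) q := by
  obtain ⟨q₁, h1, h2⟩ := exists_between hq
  have hs := (summable_lagTerm ha (hq0.trans h1).le h2 x y).norm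
  have : ContinuousOn (fun q => lagKernel a q x y) (Set.Ioo 0 q₁) := by
    refine continuousOn_tsum (fun n => ?_) hs fun n r hr => ?_
    · unfold lagTerm; fun_prop
    · unfold lagTerm
      rw [norm_mul, norm_mul _ (q₁ ^ n), Real.norm_of_nonneg (pow_nonneg hr.1.le n),
        Real.norm_of_nonneg (pow_nonneg (hq0.trans h1).le n)]
      gcongr
      · exact hr.1.le
      · exact hr.2.le
  exact this.continuousAt (Ioo_mem_nhds hq0 h1)

theorem continuousAt_kernel {μ t : ℝ} (hμ : -(1 / 2) < μ) (ht : 0 < t) (x y : ℝ) :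
    ContinuousAt (fun t => kernel μ t x y) t := by
  have hq := exp_neg_sq_lt_one ht
  have he : ContinuousAt (fun t : ℝ => Real.exp (-t) ^ 2) t := by fun_prop
  have h : ∀ a : ℝ, 0 < a → ContinuousAt
      (fun t : ℝ => lagKernel a (Real.exp (-t) ^ 2) (x ^ 2) (y ^ 2)) t := fun a ha =>
    ContinuousAt.comp (g := fun q => lagKernel a q (x ^ 2) (y ^ 2))
      (continuousAt_lagKernel ha (by positivity) hq _ _) he
  have h1 := h (μ + 1 / 2) (by linarith)
  have h2 := h (μ + 1 / 2 + 1) (by linarith)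
  have hE : ContinuousAt (fun t : ℝ => Real.exp (-t) * x * y) t := by fun_prop
  refine (h1.add (hE.mul h2)).congr ?_
  filter_upwards [Ioi_mem_nhds ht] with s hs
  exact (kernel_eq hμ hs x y).symm

/-! ### The even part of the semigroup -/

/-- The even part of the semigroup, on functions with values in `[0, ∞]`. -/
def evenAvg (μ t : ℝ) (f : ℝ → ℝ≥0∞) (x : ℝ) : ℝ≥0∞ :=
  ∫⁻ y, ENNReal.ofReal (evenKernel μ t x y) * f y ∂(lam μ)

theorem measurable_ofReal_evenKernel {μ t : ℝ} (hμ : -(1 / 2) < μ) (ht : 0 < t) :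
    Measurable (Function.uncurry fun x y => ENNReal.ofReal (evenKernel μ t x y)) :=
  (measurable_evenKernel hμ ht).ennreal_ofReal

theorem measurable_ofReal_evenKernel_right {μ t : ℝ} (hμ : -(1 / 2) < μ) (ht : 0 < t) (x : ℝ) :
    Measurable fun y => ENNReal.ofReal (evenKernel μ t x y) :=
  Measurable.comp (g := fun z : ℝ × ℝ => ENNReal.ofReal (evenKernel μ t z.1 z.2))
    (f := fun y => (x, y)) (measurable_ofReal_evenKernel hμ ht) measurable_prodMk_left

theorem lintegral_evenKernel {μ t : ℝ} (hμ : -(1 / 2) < μ) (ht : 0 < t) (x : ℝ) :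
    ∫⁻ y, ENNReal.ofReal (evenKernel μ t x y) ∂(lam μ) = 1 := by
  have h : ∫ y, evenKernel μ t x y ∂(lam μ) = 1 :=
    integral_lagKernel hμ rfl (by positivity) (exp_neg_sq_lt_one ht) (x ^ 2)
  rw [← ofReal_integral_eq_lintegral_ofReal (integrable_of_integral_eq_one h)
    (Filter.Eventually.of_forall fun y => evenKernel_nonneg hμ ht x y)]
  rw [h, ENNReal.ofReal_one]

theorem lintegral_evenKernel_mul {μ s t : ℝ} (hμ : -(1 / 2) < μ) (hs : 0 < s) (ht : 0 < t)
    (x z : ℝ) :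
    ∫⁻ y, ENNReal.ofReal (evenKernel μ s x y) * ENNReal.ofReal (evenKernel μ t y z) ∂(lam μ) =
      ENNReal.ofReal (evenKernel μ (s + t) x z) := by
  have h := integral_lagKernel_mul_lagKernel hμ rfl (by positivity) (exp_neg_sq_lt_one hs)
    (by positivity) (exp_neg_sq_lt_one ht) (x ^ 2) (z ^ 2)
  rw [← mul_pow, ← Real.exp_add, ← neg_add] at h
  simp only [← ENNReal.ofReal_mul (evenKernel_nonneg hμ hs _ _)]
  -- One factor of the product has integral one and the other is bounded, hence the product is
  -- integrable.
  obtain ⟨M, hM⟩ := exists_evenKernel_le hμ ht z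
  have hi : Integrable (fun y => evenKernel μ s x y * evenKernel μ t y z) (lam μ) := by
    have h1 : Integrable (fun y => evenKernel μ s x y) (lam μ) := integrable_of_integral_eq_one
      (integral_lagKernel hμ rfl (by positivity) (exp_neg_sq_lt_one hs) (x ^ 2))
    refine h1.mul_bdd (c := M) ?_ (Filter.Eventually.of_forall fun y => ?_)
    · exact (Measurable.comp (g := fun z : ℝ × ℝ => evenKernel μ t z.1 z.2) (f := fun y => (y, z))
        (measurable_evenKernel hμ ht) measurable_prodMk_right).aestronglyMeasurable
    · rw [Real.norm_of_nonneg (evenKernel_nonneg hμ ht y z), evenKernel_comm]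
      exact hM t le_rfl y
  rw [← ofReal_integral_eq_lintegral_ofReal hi (Filter.Eventually.of_forall fun y =>
    mul_nonneg (evenKernel_nonneg hμ hs x y) (evenKernel_nonneg hμ ht y z))]
  exact congrArg ENNReal.ofReal h

theorem evenAvg_evenAvg {μ s t : ℝ} (hμ : -(1 / 2) < μ) (hs : 0 < s) (ht : 0 < t)
    {f : ℝ → ℝ≥0∞} (hf : Measurable f) : evenAvg μ s (evenAvg μ t f) = evenAvg μ (s + t) f := by
  have := isFiniteMeasure_lam hμ
  ext x
  have h1 := measurable_ofReal_evenKernel_right hμ hs x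
  have h2 := measurable_ofReal_evenKernel hμ ht
  have h2' : ∀ y, Measurable fun z => ENNReal.ofReal (evenKernel μ t y z) * f z :=
    fun y => (measurable_ofReal_evenKernel_right hμ ht y).mul hf
  have h2'' : ∀ z, Measurable fun y => ENNReal.ofReal (evenKernel μ t y z) :=
    fun z => by
      simp only [evenKernel_comm μ t _ z]
      exact measurable_ofReal_evenKernel_right hμ ht z
  have h3 : Measurable (Function.uncurry fun y z => ENNReal.ofReal (evenKernel μ s x y) *
      (ENNReal.ofReal (evenKernel μ t y z) * f z)) :=
    (h1.comp measurable_fst).mul (h2.mul (hf.comp measurable_snd))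
  unfold evenAvg
  simp only [← lintegral_const_mul _ (h2' _)]
  rw [lintegral_lintegral_swap h3.aemeasurable]
  refine lintegral_congr fun z => ?_
  have h4 : Measurable fun y =>
      ENNReal.ofReal (evenKernel μ s x y) * ENNReal.ofReal (evenKernel μ t y z) := h1.mul (h2'' z)
  simp only [← mul_assoc]
  rw [lintegral_mul_const _ h4, lintegral_evenKernel_mul hμ hs ht]

instance (μ : ℝ) : SFinite (lam μ) := by unfold lam; infer_instance

/-- The Markov kernel of the even part of the semigroup. -/
def evenMarkov (μ t : ℝ) : Kernel ℝ ℝ :=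
  Kernel.withDensity (Kernel.const ℝ (lam μ)) fun x y => ENNReal.ofReal (evenKernel μ t x y)

theorem evenMarkov_apply {μ t : ℝ} (hμ : -(1 / 2) < μ) (ht : 0 < t) (x : ℝ) :
    evenMarkov μ t x = (lam μ).withDensity fun y => ENNReal.ofReal (evenKernel μ t x y) := by
  rw [evenMarkov, Kernel.withDensity_apply _ (measurable_ofReal_evenKernel hμ ht),
    Kernel.const_apply]

theorem isMarkovKernel_evenMarkov {μ t : ℝ} (hμ : -(1 / 2) < μ) (ht : 0 < t) :
    IsMarkovKernel (evenMarkov μ t) := by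
  refine ⟨fun x => ⟨?_⟩⟩
  rw [evenMarkov_apply hμ ht, withDensity_apply _ MeasurableSet.univ, Measure.restrict_univ,
    lintegral_evenKernel hμ ht]

theorem avg_evenMarkov {μ t : ℝ} (hμ : -(1 / 2) < μ) (ht : 0 < t) {f : ℝ → ℝ≥0∞}
    (hf : Measurable f) : avg (evenMarkov μ t) f = evenAvg μ t f := by
  ext x
  rw [avg, evenMarkov_apply hμ ht,
    lintegral_withDensity_eq_lintegral_mul _ (measurable_ofReal_evenKernel_right hμ ht x) hf]
  rfl

theorem measurable_evenAvg {μ t : ℝ} (hμ : -(1 / 2) < μ) (ht : 0 < t) {f : ℝ → ℝ≥0∞}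
    (hf : Measurable f) : Measurable (evenAvg μ t f) :=
  avg_evenMarkov hμ ht hf ▸ measurable_avg _ hf

theorem isSymmetricKernel_evenMarkov {μ t : ℝ} (hμ : -(1 / 2) < μ) (ht : 0 < t) :
    IsSymmetricKernel (evenMarkov μ t) (lam μ) := by
  have := isFiniteMeasure_lam hμ
  intro f g hf hg
  have h := measurable_ofReal_evenKernel hμ ht
  have h1 := measurable_ofReal_evenKernel_right hμ ht
  rw [avg_evenMarkov hμ ht hf, avg_evenMarkov hμ ht hg]
  unfold evenAvg
  have hg' : ∀ x, Measurable fun y => ENNReal.ofReal (evenKernel μ t x y) * g y :=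
    fun x => (h1 x).mul hg
  have hf' : ∀ x, Measurable fun y => ENNReal.ofReal (evenKernel μ t x y) * f y :=
    fun x => (h1 x).mul hf
  simp only [← lintegral_const_mul _ (hg' _), ← lintegral_mul_const _ (hf' _)]
  rw [lintegral_lintegral_swap]
  · refine lintegral_congr fun y => lintegral_congr fun x => ?_
    rw [evenKernel_comm]
    ring
  · exact ((h.mul (hf.comp measurable_snd)).mul (hg.comp measurable_fst)).aemeasurable

theorem avg_evenMarkov_iterate {μ t : ℝ} (hμ : -(1 / 2) < μ) (ht : 0 < t) {f : ℝ → ℝ≥0∞}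
    (hf : Measurable f) (n : ℕ) :
    (avg (evenMarkov μ t))^[n + 1] f = evenAvg μ ((n + 1) * t) f := by
  induction n with
  | zero => simp [avg_evenMarkov hμ ht hf]
  | succ n ih =>
    have hnt : 0 < ((n : ℝ) + 1) * t := by positivity
    rw [Function.iterate_succ_apply', ih, avg_evenMarkov hμ ht (measurable_evenAvg hμ hnt hf),
      evenAvg_evenAvg hμ ht hnt hf]
    congr 1
    push_cast
    ring

/-- The maximal function over the times `(n + 1) / 2ʲ`. -/
def gridMax (μ : ℝ) (f : ℝ → ℝ≥0∞) (j : ℕ) (x : ℝ) : ℝ≥0∞ :=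
  ⨆ n : ℕ, evenAvg μ ((n + 1) / 2 ^ j) f x

theorem measurable_gridMax {μ : ℝ} (hμ : -(1 / 2) < μ) {f : ℝ → ℝ≥0∞} (hf : Measurable f) (j : ℕ) :
    Measurable (gridMax μ f j) :=
  Measurable.iSup fun _ => measurable_evenAvg hμ (by positivity) hf

theorem gridMax_mono (μ : ℝ) (f : ℝ → ℝ≥0∞) : Monotone (gridMax μ f) := by
  refine monotone_nat_of_le_succ fun j x => iSup_le fun n => ?_
  -- The time `(n + 1) / 2^j` is `(2 n + 2) / 2^{j+1}` on the next grid.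
  refine le_iSup_of_le (2 * n + 1) (le_of_eq ?_)
  congr 1
  push_cast
  rw [pow_succ]
  field_simp
  ring

theorem lintegral_gridMax_rpow_le {μ : ℝ} (hμ : -(1 / 2) < μ) {p q : ℝ}
    (hpq : p.HolderConjugate q) {f : ℝ → ℝ≥0∞} (hf : Measurable f) (j : ℕ) :
    ∫⁻ x, gridMax μ f j x ^ p ∂(lam μ) ≤ ENNReal.ofReal q ^ p * ∫⁻ x, f x ^ p ∂(lam μ) := by
  have := isFiniteMeasure_lam hμ
  -- Half the grid step: the even power `2 (n + 1)` of this operator is the operator at time `(n +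
  -- 1) / 2^j`.
  have ht : (0 : ℝ) < 1 / 2 ^ (j + 1) := by positivity
  have := isMarkovKernel_evenMarkov hμ ht
  set κ := evenMarkov μ (1 / 2 ^ (j + 1))
  set S : ℕ → ℝ → ℝ≥0∞ := fun N x => (range N).sup (fun n => (avg κ)^[2 * n] f x) with hS
  have hSm : ∀ N, Measurable (S N) := fun N =>
    measurable_range_sup N fun n => measurable_avg_iterate κ hf _
  have hSmono : Monotone S := fun N N' h x =>
    Finset.sup_mono (Finset.range_mono h)
  have hle : ∀ x, gridMax μ f j x ≤ ⨆ N, S N x := by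
    intro x
    refine iSup_le fun n => le_iSup_of_le (n + 2) ?_
    have h1 := Finset.le_sup (f := fun n => (avg κ)^[2 * n] f x)
      (Finset.mem_range.2 (show n + 1 < n + 2 by omega))
    refine le_trans (le_of_eq ?_) h1
    rw [show 2 * (n + 1) = (2 * n + 1) + 1 by ring, avg_evenMarkov_iterate hμ ht hf]
    congr 1
    push_cast
    rw [pow_succ]
    field_simp
    ring
  calc ∫⁻ x, gridMax μ f j x ^ p ∂(lam μ) ≤ ∫⁻ x, ⨆ N, S N x ^ p ∂(lam μ) := by
        refine lintegral_mono fun x => ?_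
        refine (ENNReal.rpow_le_rpow (hle x) hpq.nonneg).trans_eq ?_
        exact (ENNReal.orderIsoRpow p hpq.pos).map_iSup _
    _ = ⨆ N, ∫⁻ x, S N x ^ p ∂(lam μ) :=
        lintegral_iSup (fun N => (hSm N).pow_const p)
          fun N N' h x => ENNReal.rpow_le_rpow (hSmono h x) hpq.nonneg
    _ ≤ _ := iSup_le fun N =>
        lintegral_sup_avg_rpow_le (isSymmetricKernel_evenMarkov hμ ht) hpq N hf

theorem lintegral_iSup_gridMax_rpow_le {μ : ℝ} (hμ : -(1 / 2) < μ) {p q : ℝ}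
    (hpq : p.HolderConjugate q) {f : ℝ → ℝ≥0∞} (hf : Measurable f) :
    ∫⁻ x, (⨆ j, gridMax μ f j x) ^ p ∂(lam μ) ≤
      ENNReal.ofReal q ^ p * ∫⁻ x, f x ^ p ∂(lam μ) := by
  calc ∫⁻ x, (⨆ j, gridMax μ f j x) ^ p ∂(lam μ) = ∫⁻ x, ⨆ j, gridMax μ f j x ^ p ∂(lam μ) :=
        lintegral_congr fun x => (ENNReal.orderIsoRpow p hpq.pos).map_iSup _
    _ = ⨆ j, ∫⁻ x, gridMax μ f j x ^ p ∂(lam μ) :=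
        lintegral_iSup (fun j => (measurable_gridMax hμ hf j).pow_const p)
          fun j j' h x => ENNReal.rpow_le_rpow (gridMax_mono μ f h x) hpq.nonneg
    _ ≤ _ := iSup_le fun j => lintegral_gridMax_rpow_le hμ hpq hf j

/-! ### The semigroup and its maximal function -/

variable {𝕜 : Type*} [RCLike 𝕜]

theorem integrable_kernel_smul {μ t : ℝ} (hμ : -(1 / 2) < μ) (ht : 0 < t) {f : ℝ → 𝕜}
    (hf : Integrable f (lam μ)) (x : ℝ) : Integrable (fun y => kernel μ t x y • f y) (lam μ) := by
  obtain ⟨M, hM⟩ := exists_evenKernel_le hμ ht x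
  refine Integrable.bdd_smul (φ := fun y => kernel μ t x y) hf
    ((1 + max 1 (1 / (μ + 1 / 2))) * M) ?_ (Filter.Eventually.of_forall fun y => ?_)
  · exact (Measurable.comp (g := fun z : ℝ × ℝ => kernel μ t z.1 z.2) (f := fun y => (x, y))
      (measurable_kernel hμ ht) measurable_prodMk_left).aestronglyMeasurable
  · refine (abs_kernel_le hμ ht x y).trans ?_
    gcongr
    exact hM t le_rfl y

theorem continuousAt_semigroup {μ t : ℝ} (hμ : -(1 / 2) < μ) (ht : 0 < t) {f : ℝ → 𝕜}
    (hf : Integrable f (lam μ)) (x : ℝ) : ContinuousAt (fun t => semigroup μ t f x) t := by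
  -- The kernel bound is uniform for times at least `t / 2`, which gives a dominating function near
  -- `t`.
  obtain ⟨M, hM⟩ := exists_evenKernel_le hμ (half_pos ht) x
  have hnear : ∀ᶠ s in nhds t, t / 2 < s := Ioi_mem_nhds (half_lt_self ht)
  refine continuousAt_of_dominated
    (bound := fun y => (1 + max 1 (1 / (μ + 1 / 2))) * M * ‖f y‖) ?_ ?_ ?_ ?_
  · filter_upwards [hnear] with s hs
    exact (integrable_kernel_smul hμ ((half_pos ht).trans hs) hf x).aestronglyMeasurable
  · filter_upwards [hnear] with s hs
    refine Filter.Eventually.of_forall fun y => ?_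
    rw [norm_smul]
    gcongr
    refine (abs_kernel_le hμ ((half_pos ht).trans hs) x y).trans ?_
    gcongr
    exact hM s hs.le y
  · exact hf.norm.const_mul _
  · exact Filter.Eventually.of_forall fun y =>
      (continuousAt_kernel hμ ht x y).smul continuousAt_const

/-- Continuity in `t` reduces the supremum to dyadic times, which yields measurability as well as
the estimate. -/
theorem maximal_eq_iSup {μ : ℝ} (hμ : -(1 / 2) < μ) {f : ℝ → 𝕜} (hf : Integrable f (lam μ))
    (x : ℝ) : maximal μ f x = ⨆ (j : ℕ) (n : ℕ), ‖semigroup μ ((n + 1) / 2 ^ j) f x‖ₑ := by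
  refine le_antisymm (iSup₂_le fun t ht => ?_) (iSup₂_le fun j n => ?_)
  -- The shift by one keeps the approximating times positive; they tend to `t` from above.
  · have hlim : Filter.Tendsto (fun j : ℕ => ((⌊t * 2 ^ j⌋₊ : ℝ) + 1) / 2 ^ j) Filter.atTop
        (nhds t) := by
      have h2 : Filter.Tendsto (fun j : ℕ => t + 1 / (2 : ℝ) ^ j) Filter.atTop (nhds t) := by
        have := (tendsto_pow_atTop_nhds_zero_of_lt_one (r := (1 / 2 : ℝ)) (by norm_num)
          (by norm_num)).const_add t
        simpa [one_div, inv_pow] using this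
      refine tendsto_of_tendsto_of_tendsto_of_le_of_le tendsto_const_nhds h2 (fun j => ?_)
        fun j => ?_
      · rw [le_div_iff₀ (by positivity)]
        exact (Nat.lt_floor_add_one _).le
      · dsimp only
        rw [add_div]
        gcongr
        rw [div_le_iff₀ (by positivity)]
        exact Nat.floor_le (by positivity)
    refine le_of_tendsto ((continuousAt_semigroup hμ ht hf x).enorm.tendsto.comp hlim)
      (Filter.Eventually.of_forall fun j => ?_)
    exact le_iSup₂_of_le (f := fun (j : ℕ) (n : ℕ) => ‖semigroup μ ((n + 1) / 2 ^ j) f x‖ₑ) j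
      ⌊t * 2 ^ j⌋₊ le_rfl
  · exact le_iSup₂_of_le (f := fun (t : ℝ) (_ : 0 < t) => ‖semigroup μ t f x‖ₑ)
      ((n + 1) / 2 ^ j) (by positivity) le_rfl

theorem measurable_semigroup {μ t : ℝ} (hμ : -(1 / 2) < μ) (ht : 0 < t) {f : ℝ → 𝕜}
    (hf : StronglyMeasurable f) : StronglyMeasurable (semigroup μ t f) := by
  have := isFiniteMeasure_lam hμ
  exact StronglyMeasurable.integral_prod_right'
    (f := fun z : ℝ × ℝ => kernel μ t z.1 z.2 • f z.2)
    ((measurable_kernel hμ ht).stronglyMeasurable.smul (hf.comp_measurable measurable_snd))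

theorem enorm_semigroup_le {μ t : ℝ} (hμ : -(1 / 2) < μ) (ht : 0 < t) (f : ℝ → 𝕜) (x : ℝ) :
    ‖semigroup μ t f x‖ₑ ≤
      ENNReal.ofReal (1 + max 1 (1 / (μ + 1 / 2))) * evenAvg μ t (fun y => ‖f y‖ₑ) x := by
  have hC : 0 ≤ 1 + max 1 (1 / (μ + 1 / 2)) := by positivity
  refine (enorm_integral_le_lintegral_enorm _).trans ?_
  rw [evenAvg, ← lintegral_const_mul' _ _ ENNReal.ofReal_ne_top]
  refine lintegral_mono fun y => ?_
  rw [enorm_smul, ← mul_assoc, ← ENNReal.ofReal_mul hC]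
  gcongr
  rw [← ofReal_norm]
  exact ENNReal.ofReal_le_ofReal (abs_kernel_le hμ ht x y)

theorem maximal_le_gridMax {μ : ℝ} (hμ : -(1 / 2) < μ) {f : ℝ → 𝕜} (hf : Integrable f (lam μ))
    (x : ℝ) : maximal μ f x ≤ ENNReal.ofReal (1 + max 1 (1 / (μ + 1 / 2))) *
      ⨆ j, gridMax μ (fun y => ‖f y‖ₑ) j x := by
  rw [maximal_eq_iSup hμ hf]
  refine iSup₂_le fun j n => (enorm_semigroup_le hμ (by positivity) f x).trans ?_
  gcongr
  exact le_iSup_of_le j (le_iSup (fun n : ℕ => evenAvg μ ((n + 1) / 2 ^ j) (fun y => ‖f y‖ₑ) x) n)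

/-- The equality holds at every point, since `f` enters only under the integral; so `f` may be
replaced by a strongly measurable representative. -/
theorem maximal_congr {μ : ℝ} {f g : ℝ → 𝕜} (h : f =ᵐ[lam μ] g) : maximal μ f = maximal μ g := by
  ext x
  refine iSup_congr fun t => iSup_congr fun _ => ?_
  rw [semigroup, semigroup, integral_congr_ae]
  filter_upwards [h] with y hy
  rw [hy]

theorem measurable_maximal {μ : ℝ} (hμ : -(1 / 2) < μ) {f : ℝ → 𝕜} (hf : Integrable f (lam μ)) :
    Measurable (maximal μ f) := by
  rw [maximal_congr hf.aestronglyMeasurable.ae_eq_mk]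
  have hf' := hf.congr hf.aestronglyMeasurable.ae_eq_mk
  rw [funext (maximal_eq_iSup hμ hf')]
  exact Measurable.iSup fun j => Measurable.iSup fun n => (measurable_semigroup hμ
    (by positivity) hf.aestronglyMeasurable.stronglyMeasurable_mk).enorm

theorem maximal_le_eLpNorm_top {μ : ℝ} (hμ : -(1 / 2) < μ) (f : ℝ → 𝕜) (x : ℝ) :
    maximal μ f x ≤ ENNReal.ofReal (1 + max 1 (1 / (μ + 1 / 2))) * eLpNorm f ∞ (lam μ) := by
  refine iSup₂_le fun t ht => (enorm_semigroup_le hμ ht f x).trans ?_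
  gcongr
  calc evenAvg μ t (fun y => ‖f y‖ₑ) x
      ≤ ∫⁻ y, ENNReal.ofReal (evenKernel μ t x y) * eLpNorm f ∞ (lam μ) ∂(lam μ) := by
        refine lintegral_mono_ae ?_
        filter_upwards [ae_le_eLpNormEssSup (f := f) (μ := lam μ)] with y hy
        rw [eLpNorm_exponent_top]
        gcongr
    _ = eLpNorm f ∞ (lam μ) := by
        rw [lintegral_mul_const _ (measurable_ofReal_evenKernel_right hμ ht x),
          lintegral_evenKernel hμ ht, one_mul]

theorem eLpNorm_maximal_le {μ : ℝ} (hμ : -(1 / 2) < μ) {p q : ℝ} (hpq : p.HolderConjugate q)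
    {f : ℝ → 𝕜} (hf : Integrable f (lam μ)) :
    eLpNorm (maximal μ f) (ENNReal.ofReal p) (lam μ) ≤
      ENNReal.ofReal (1 + max 1 (1 / (μ + 1 / 2))) * ENNReal.ofReal q *
        eLpNorm f (ENNReal.ofReal p) (lam μ) := by
  have hfg := hf.aestronglyMeasurable.ae_eq_mk
  rw [maximal_congr hfg, eLpNorm_congr_ae hfg]
  have hg := hf.congr hfg
  have hgm := hf.aestronglyMeasurable.stronglyMeasurable_mk
  generalize hf.aestronglyMeasurable.mk f = g at hg hgm
  have hp0 : ENNReal.ofReal p ≠ 0 := by simpa using hpq.pos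
  rw [eLpNorm_eq_lintegral_rpow_enorm_toReal hp0 ENNReal.ofReal_ne_top,
    eLpNorm_eq_lintegral_rpow_enorm_toReal hp0 ENNReal.ofReal_ne_top,
    ENNReal.toReal_ofReal hpq.nonneg]
  set C := ENNReal.ofReal (1 + max 1 (1 / (μ + 1 / 2)))
  have hm := hgm.enorm
  calc (∫⁻ x, ‖maximal μ g x‖ₑ ^ p ∂(lam μ)) ^ (1 / p)
      ≤ (∫⁻ x, C ^ p * (⨆ j, gridMax μ (fun y => ‖g y‖ₑ) j x) ^ p ∂(lam μ)) ^ (1 / p) := by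
        gcongr with x
        · exact one_div_nonneg.2 hpq.nonneg
        · rw [← ENNReal.mul_rpow_of_nonneg _ _ hpq.nonneg]
          exact ENNReal.rpow_le_rpow (maximal_le_gridMax hμ hg x) hpq.nonneg
    _ ≤ (C ^ p * (ENNReal.ofReal q ^ p * ∫⁻ x, ‖g x‖ₑ ^ p ∂(lam μ))) ^ (1 / p) := by
        refine ENNReal.rpow_le_rpow ?_ (one_div_nonneg.2 hpq.nonneg)
        rw [lintegral_const_mul']
        · gcongr
          exact lintegral_iSup_gridMax_rpow_le hμ hpq hm
        · exact ENNReal.rpow_ne_top_of_nonneg hpq.nonneg ENNReal.ofReal_ne_top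
    _ = _ := by
        have h1 := one_div_nonneg.2 hpq.nonneg
        rw [ENNReal.mul_rpow_of_nonneg _ _ h1, ENNReal.mul_rpow_of_nonneg _ _ h1,
          ← ENNReal.rpow_mul, ← ENNReal.rpow_mul, mul_one_div_cancel hpq.ne_zero,
          ENNReal.rpow_one, ENNReal.rpow_one, mul_assoc]

end GenOU

end

/-- For `μ > -1/2` and `1 < p ≤ ∞` the maximal operator is bounded on `L^p(dλ_μ)`. The series for
the kernel and the integrals for `T_μ^t f` converge absolutely, so no default value enters. -/
theorem corollary2p2 {𝕜 : Type*} [RCLike 𝕜] (μ : ℝ) (hμ : -(1 / 2) < μ)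
    (p : ℝ≥0∞) (hp : 1 < p) :
    (∀ t : ℝ, 0 < t → ∀ x y : ℝ, Summable (GenOU.kernelTerm μ t x y)) ∧
    ∃ C : ℝ≥0, ∀ f : ℝ → 𝕜, MemLp f p (GenOU.lam μ) →
      (∀ t : ℝ, 0 < t → ∀ x : ℝ,
        Integrable (fun y => GenOU.kernel μ t x y • f y) (GenOU.lam μ)) ∧
      AEMeasurable (GenOU.maximal μ f) (GenOU.lam μ) ∧
      eLpNorm (GenOU.maximal μ f) p (GenOU.lam μ) ≤ C * eLpNorm f p (GenOU.lam μ) := by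
  have := GenOU.isFiniteMeasure_lam hμ
  refine ⟨fun t ht x y => (GenOU.hasSum_kernelTerm hμ ht x y).summable, ?_⟩
  suffices h : ∃ C : ℝ≥0, ∀ f : ℝ → 𝕜, Integrable f (GenOU.lam μ) →
      eLpNorm (GenOU.maximal μ f) p (GenOU.lam μ) ≤ C * eLpNorm f p (GenOU.lam μ) by
    obtain ⟨C, hC⟩ := h
    refine ⟨C, fun f hf => ?_⟩
    -- The measure is finite, so `L^p` lies in `L^1` and all integrals make sense.
    have hfi := hf.integrable hp.le
    exact ⟨fun t ht x => GenOU.integrable_kernel_smul hμ ht hfi x,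
      (GenOU.measurable_maximal hμ hfi).aemeasurable, hC f hfi⟩
  rcases eq_or_ne p ∞ with rfl | hpt
  · refine ⟨(1 + max 1 (1 / (μ + 1 / 2))).toNNReal, fun f _ => ?_⟩
    rw [eLpNorm_exponent_top]
    exact essSup_le_of_ae_le _ (Filter.Eventually.of_forall fun x =>
      GenOU.maximal_le_eLpNorm_top hμ f x)
  · have hp1 : 1 < p.toReal := by
      rw [← ENNReal.toReal_one]
      exact (ENNReal.toReal_lt_toReal ENNReal.one_ne_top hpt).2 hp
    have hpq := Real.HolderConjugate.conjExponent hp1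
    refine ⟨(1 + max 1 (1 / (μ + 1 / 2))).toNNReal * p.toReal.conjExponent.toNNReal,
      fun f hf => ?_⟩
    have := GenOU.eLpNorm_maximal_le hμ hpq hf
    rw [ENNReal.ofReal_toReal hpt] at this
    rw [ENNReal.coe_mul]
    exact this
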